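/- Let $G$ be a compact connected Lie group whose (automatically reductive) real Lie algebra $\mathfrak g$ is not simple and not abelian. Then there exist an element $g\in G$ with $g\neq e$ and a sequence $(\pi_k)_{k\ge 0}$ of continuous irreducible complex representations of $G$ of finite dimensions $d_k$ with $d_k\to\infty$ such that the normalized characters $$\frac{\chi_{\pi_k}(g)}{d_k}=\frac{\operatorname{Tr}\pi_k(g)}{d_k}$$ do not converge to $0$ as $k\to\infty$. (A Lie algebra is called simple if it is non-abelian and has no ideals other than $0$ and itself.) -/

import Mathlib

open Filter Topology
open scoped Manifold ContDiff

/-- The Lie bracket on the Lie algebra of a real Lie group is available in Mathlib for groups of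
class `minSmoothness ℝ 3` (that is, `C^3`); smooth Lie groups are of this class. -/
instance lieGroup_minSmoothness_of_smooth {E : Type*} [NormedAddCommGroup E] [NormedSpace ℝ E]
    {G : Type*} [TopologicalSpace G] [ChartedSpace E G] [Group G] [LieGroup 𝓘(ℝ, E) ∞ G] :
    LieGroup 𝓘(ℝ, E) (minSmoothness ℝ 3) G :=
  LieGroup.of_le (m := minSmoothness ℝ 3) (n := ∞) (by
    rw [minSmoothness_of_isRCLikeNormedField]
    exact ENat.LEInfty.out)

/-- A representation of a topological group on a topological complex vector space is continuous
if the action map `G × V → V` is continuous. -/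
def Representation.IsContinuousRep {G V : Type*} [TopologicalSpace G] [Group G]
    [TopologicalSpace V] [AddCommGroup V] [Module ℂ V] (ρ : Representation ℂ G V) : Prop :=
  Continuous fun p : G × V => ρ p.1 p.2

/-- The normalized character `g ↦ χ_ρ(g) / dim V`. -/
noncomputable def Representation.normalizedCharacter {G V : Type*} [Group G]
    [AddCommGroup V] [Module ℂ V] (ρ : Representation ℂ G V) (g : G) : ℂ :=
  ρ.character g / (Module.finrank ℂ V : ℂ)

/-! A compact group preserves an inner product on its Lie algebra, so the orthogonal complement of a
proper nonzero ideal is again an ideal and the algebra is a sum of two commuting nonzero ideals. One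
of them, say `J`, is non-abelian; call the other `I`. The adjoint action on `J` has differential
zero on `I`, so it is trivial at some `g₀ ≠ 1` (`exists_ne_one_map_eq_one`). Every representation
built from it is also trivial at `g₀`, where its normalized character is 1. It remains to find
irreducible ones of unbounded dimension (`exists_representations_of_isCompl`).

Highest weights are avoided. Take `X = [x, y] ≠ 0` with `x, y` in `J`. Since `ad X` is skew, it is
not nilpotent on `J`, so its complexification has an eigenvalue `c ≠ 0`. Repeated tensor squaring
gives eigenvalues `2 ^ m * c` of `X`, and each survives in some irreducible subquotient
(`exists_admissible_pow_two`).

Conversely, in an irreducible representation of dimension `d` every eigenvalue of `X` has modulus at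
most `d * R`, where `R` bounds the spectrum of `ad X` (`norm_eigenvalue_le`). Indeed the operators
of the Lie algebra move generalized eigenspaces of `X` by steps of length at most `R`. A larger gap
in the spectrum would split the representation, so the spectrum has diameter at most `d * R`. Its
mean is 0 because a commutator has trace 0. As `2 ^ m * ‖c‖` grows and `R` is fixed, the dimensions
are unbounded. -/

/-! ### Local group laws: commutators of left-invariant fields. -/

section Calculus

variable {E : Type*} [NormedAddCommGroup E] [NormedSpace ℝ E]

/-- For a local multiplication `m` with neutral element `e`, conjugation `c` and
`m (x, y) = m (c (x, y), x)`, the commutator of the left invariant fields is the derivative of the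
adjoint action. -/
theorem fderiv_sub_fderiv_eq_of_conj {m c : E × E → E} {e : E}
    (hm : ContDiffAt ℝ ∞ m (e, e)) (hc : ContDiffAt ℝ ∞ c (e, e))
    (hm1 : ∀ᶠ x in 𝓝 e, m (x, e) = x)
    (hc1 : ∀ᶠ x in 𝓝 e, c (x, e) = e) (hc2 : ∀ᶠ y in 𝓝 e, c (e, y) = y)
    (hmc : ∀ᶠ p in 𝓝 (e, e), m p = m (c p, p.1)) (X Y : E) :
    fderiv ℝ (fun x => fderiv ℝ m (x, e) (0, Y)) e X
      - fderiv ℝ (fun x => fderiv ℝ m (x, e) (0, X)) e Y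
      = fderiv ℝ (fun x => fderiv ℝ c (x, e) (0, Y)) e X := by
  have hce : c (e, e) = e := hc1.self_of_nhds
  have hmd : ∀ᶠ p in 𝓝 (e, e), DifferentiableAt ℝ m p :=
    ((hm.of_le (m := 1) ENat.LEInfty.out).eventually (by simp)).mono fun p hp =>
      hp.differentiableAt (by simp)
  have hcd : ∀ᶠ p in 𝓝 (e, e), DifferentiableAt ℝ c p :=
    ((hc.of_le (m := 1) ENat.LEInfty.out).eventually (by simp)).mono fun p hp =>
      hp.differentiableAt (by simp)
  have hl : Tendsto (fun x : E => (x, e)) (𝓝 e) (𝓝 (e, e)) :=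
    (Continuous.prodMk_left e).continuousAt
  have hr : Tendsto (fun x : E => (e, x)) (𝓝 e) (𝓝 (e, e)) :=
    (Continuous.prodMk_right e).continuousAt
  -- The identity `m (x, y) = m (c (x, y), x)` differentiated in `y` at `e`. Differentiating `key`
  -- once more in `x` along `X`, the symmetry of the second derivative of `m` turns the mixed term
  -- into the second term of the commutator.
  have key : ∀ᶠ x in 𝓝 e, fderiv ℝ m (x, e) (0, Y) =
      fderiv ℝ m (e, x) (fderiv ℝ c (x, e) (0, Y), 0) := by
    filter_upwards [hl.eventually hmd, hr.eventually hmd, hl.eventually hcd, hc1,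
      hl.eventually hmc.eventually_nhds] with x h1 h2 h3 h4 h5
    have hx : HasFDerivAt (fun y : E => (x, y)) (ContinuousLinearMap.inr ℝ E E) e :=
      hasFDerivAt_prodMk_right x e
    have e1 : HasFDerivAt (fun y => m (x, y)) _ e := h1.hasFDerivAt.comp e hx
    have e2 : HasFDerivAt (fun y => c (x, y)) _ e := h3.hasFDerivAt.comp e hx
    have e3 : HasFDerivAt (fun y => (c (x, y), x)) _ e := e2.prodMk (hasFDerivAt_const x e)
    have h2' : HasFDerivAt m (fderiv ℝ m (e, x)) (c (x, e), x) := by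
      rw [h4]; exact h2.hasFDerivAt
    have e4 := h2'.comp e e3
    have : (fun y => m (x, y)) =ᶠ[𝓝 e] (m ∘ fun y => (c (x, y), x)) :=
      ((Continuous.prodMk_right x).continuousAt).eventually h5
    have e5 := (e4.congr_of_eventuallyEq this).unique e1
    have := congrArg (fun f => f Y) e5
    simpa using this.symm
  have hm2 : DifferentiableAt ℝ (fderiv ℝ m) (e, e) :=
    (hm.fderiv_right (m := 1) (by norm_cast)).differentiableAt (by simp)
  have hc3 : DifferentiableAt ℝ (fderiv ℝ c) (e, e) :=
    (hc.fderiv_right (m := 1) (by norm_cast)).differentiableAt (by simp)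
  have dl : HasFDerivAt (fun x : E => (x, e)) (ContinuousLinearMap.inl ℝ E E) e :=
    hasFDerivAt_prodMk_left e e
  have dr : HasFDerivAt (fun x : E => (e, x)) (ContinuousLinearMap.inr ℝ E E) e :=
    hasFDerivAt_prodMk_right e e
  have sym := hm.isSymmSndFDerivAt
    (by rw [minSmoothness_of_isRCLikeNormedField]; exact ENat.LEInfty.out)
  have d1 (Z : E) : HasFDerivAt (fun x => fderiv ℝ m (x, e) (0, Z)) _ e :=
    (HasFDerivAt.comp (f := fun x : E => (x, e)) e hm2.hasFDerivAt dl).clm_apply (hasFDerivAt_const ((0 : E), Z) e)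
  have d2 : HasFDerivAt (fun x => fderiv ℝ c (x, e) (0, Y)) _ e :=
    (HasFDerivAt.comp (f := fun x : E => (x, e)) e hc3.hasFDerivAt dl).clm_apply (hasFDerivAt_const ((0 : E), Y) e)
  have d3 : HasFDerivAt (fun x => (fderiv ℝ c (x, e) (0, Y), (0 : E))) _ e :=
    d2.prodMk (hasFDerivAt_const (0 : E) e)
  have d4 := (HasFDerivAt.comp (f := fun x : E => (e, x)) e hm2.hasFDerivAt dr).clm_apply d3
  have d5 := (d4.congr_of_eventuallyEq key).unique (d1 Y)
  have a1 (Z : E) : fderiv ℝ m (e, e) (Z, 0) = Z := by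
    have h1 : HasFDerivAt (fun x => m (x, e)) _ e :=
      HasFDerivAt.comp (f := fun x : E => (x, e)) e hmd.self_of_nhds.hasFDerivAt dl
    have h2 := (h1.congr_of_eventuallyEq (EventuallyEq.symm hm1)).unique (hasFDerivAt_id e)
    simpa using congrArg (fun f => f Z) h2
  have a2 (Z : E) : fderiv ℝ c (e, e) (0, Z) = Z := by
    have h1 : HasFDerivAt (fun x => c (e, x)) _ e :=
      HasFDerivAt.comp (f := fun x : E => (e, x)) e hcd.self_of_nhds.hasFDerivAt dr
    have h2 := (h1.congr_of_eventuallyEq (EventuallyEq.symm hc2)).unique (hasFDerivAt_id e)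
    simpa using congrArg (fun f => f Z) h2
  have d6 := congrArg (fun f => f X) d5
  rw [(d1 Y).fderiv, (d1 X).fderiv, d2.fderiv]
  simp [a1, a2] at d6 ⊢
  rw [← d6, sym.eq (0, X) (Y, 0)]
  abel

end Calculus

/-! ### Multiplication and conjugation in the chart at the identity. -/

section Adjoint

variable {E : Type*} [NormedAddCommGroup E] [NormedSpace ℝ E]
  {G : Type*} [TopologicalSpace G] [ChartedSpace E G] [Group G] [LieGroup 𝓘(ℝ, E) ∞ G]

/-- The adjoint action of a Lie group on its Lie algebra. -/
noncomputable def adMap (E : Type*) [NormedAddCommGroup E] [NormedSpace ℝ E]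
    {G : Type*} [TopologicalSpace G] [ChartedSpace E G] [Group G] (g : G) : E →L[ℝ] E :=
  mfderiv 𝓘(ℝ, E) 𝓘(ℝ, E) (fun h : G => g * h * g⁻¹) 1

/-- The derivative at the identity of a map from a Lie group to a vector space. -/
noncomputable def derivOne {W : Type*} [NormedAddCommGroup W] [NormedSpace ℝ W]
    (f : G → W) : E →L[ℝ] W :=
  mfderiv 𝓘(ℝ, E) 𝓘(ℝ, W) f 1

theorem contMDiff_conj (g : G) : ContMDiff 𝓘(ℝ, E) 𝓘(ℝ, E) ∞ (fun h : G => g * h * g⁻¹) :=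
  (contMDiff_mul_left (a := g)).mul contMDiff_const

theorem mdifferentiable_conj (g : G) :
    MDifferentiable 𝓘(ℝ, E) 𝓘(ℝ, E) (fun h : G => g * h * g⁻¹) :=
  (contMDiff_conj g).mdifferentiable (by simp)

/-- Multiplication read in the preferred chart at the identity. -/
noncomputable def chartMul (E : Type*) [NormedAddCommGroup E] [NormedSpace ℝ E]
    (G : Type*) [TopologicalSpace G] [ChartedSpace E G] [Group G] (p : E × E) : E :=
  extChartAt 𝓘(ℝ, E) (1 : G)
    ((extChartAt 𝓘(ℝ, E) (1 : G)).symm p.1 * (extChartAt 𝓘(ℝ, E) (1 : G)).symm p.2)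

/-- Conjugation read in the preferred chart at the identity. -/
noncomputable def chartConj (E : Type*) [NormedAddCommGroup E] [NormedSpace ℝ E]
    (G : Type*) [TopologicalSpace G] [ChartedSpace E G] [Group G] (p : E × E) : E :=
  extChartAt 𝓘(ℝ, E) (1 : G)
    ((extChartAt 𝓘(ℝ, E) (1 : G)).symm p.1 * (extChartAt 𝓘(ℝ, E) (1 : G)).symm p.2 *
      ((extChartAt 𝓘(ℝ, E) (1 : G)).symm p.1)⁻¹)

theorem contMDiffAt_extChartAt_symm_one :
    ContMDiffAt 𝓘(ℝ, E) 𝓘(ℝ, E) ∞ (extChartAt 𝓘(ℝ, E) (1 : G)).symm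
      (extChartAt 𝓘(ℝ, E) (1 : G) 1) :=
  have : IsManifold 𝓘(ℝ, E) ∞ G := inferInstance
  (contMDiffOn_extChartAt_symm (1 : G)).contMDiffAt (extChartAt_target_mem_nhds (1 : G))

theorem contDiffAt_chartMul :
    ContDiffAt ℝ ∞ (chartMul E G)
      (extChartAt 𝓘(ℝ, E) (1 : G) 1, extChartAt 𝓘(ℝ, E) (1 : G) 1) := by
  have : IsManifold 𝓘(ℝ, E) ∞ G := inferInstance
  set e := extChartAt 𝓘(ℝ, E) (1 : G) 1 with he
  have h1 : ContMDiffAt (𝓘(ℝ, E × E)) 𝓘(ℝ, E) ∞ (fun p : E × E =>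
      (extChartAt 𝓘(ℝ, E) (1 : G)).symm p.1) (e, e) :=
    ContMDiffAt.comp (I' := 𝓘(ℝ, E)) (e, e) contMDiffAt_extChartAt_symm_one
      contDiffAt_fst.contMDiffAt
  have h2 : ContMDiffAt (𝓘(ℝ, E × E)) 𝓘(ℝ, E) ∞ (fun p : E × E =>
      (extChartAt 𝓘(ℝ, E) (1 : G)).symm p.2) (e, e) :=
    ContMDiffAt.comp (I' := 𝓘(ℝ, E)) (e, e) contMDiffAt_extChartAt_symm_one
      contDiffAt_snd.contMDiffAt
  have h3 := h1.mul h2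
  have h4 : ContMDiffAt 𝓘(ℝ, E) 𝓘(ℝ, E) ∞ (extChartAt 𝓘(ℝ, E) (1 : G))
     ((fun p : E × E => (extChartAt 𝓘(ℝ, E) (1 : G)).symm p.1 *
      (extChartAt 𝓘(ℝ, E) (1 : G)).symm p.2) (e, e)) := by
    have : ((fun p : E × E => (extChartAt 𝓘(ℝ, E) (1 : G)).symm p.1 *
      (extChartAt 𝓘(ℝ, E) (1 : G)).symm p.2) (e, e)) = 1 := by simp [he]
    rw [this]
    exact contMDiffAt_extChartAt
  exact (h4.comp (e, e) h3).contDiffAt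

theorem contDiffAt_chartConj :
    ContDiffAt ℝ ∞ (chartConj E G)
      (extChartAt 𝓘(ℝ, E) (1 : G) 1, extChartAt 𝓘(ℝ, E) (1 : G) 1) := by
  have : IsManifold 𝓘(ℝ, E) ∞ G := inferInstance
  set e := extChartAt 𝓘(ℝ, E) (1 : G) 1 with he
  have h1 : ContMDiffAt (𝓘(ℝ, E × E)) 𝓘(ℝ, E) ∞ (fun p : E × E =>
      (extChartAt 𝓘(ℝ, E) (1 : G)).symm p.1) (e, e) :=
    ContMDiffAt.comp (I' := 𝓘(ℝ, E)) (e, e) contMDiffAt_extChartAt_symm_one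
      contDiffAt_fst.contMDiffAt
  have h2 : ContMDiffAt (𝓘(ℝ, E × E)) 𝓘(ℝ, E) ∞ (fun p : E × E =>
      (extChartAt 𝓘(ℝ, E) (1 : G)).symm p.2) (e, e) :=
    ContMDiffAt.comp (I' := 𝓘(ℝ, E)) (e, e) contMDiffAt_extChartAt_symm_one
      contDiffAt_snd.contMDiffAt
  have h3 := (h1.mul h2).mul h1.inv
  have h4 : ContMDiffAt 𝓘(ℝ, E) 𝓘(ℝ, E) ∞ (extChartAt 𝓘(ℝ, E) (1 : G))
     ((fun p : E × E => (extChartAt 𝓘(ℝ, E) (1 : G)).symm p.1 *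
      (extChartAt 𝓘(ℝ, E) (1 : G)).symm p.2 *
      ((extChartAt 𝓘(ℝ, E) (1 : G)).symm p.1)⁻¹) (e, e)) := by
    have : ((fun p : E × E => (extChartAt 𝓘(ℝ, E) (1 : G)).symm p.1 *
      (extChartAt 𝓘(ℝ, E) (1 : G)).symm p.2 *
      ((extChartAt 𝓘(ℝ, E) (1 : G)).symm p.1)⁻¹) (e, e)) = 1 := by simp [he]
    rw [this]
    exact contMDiffAt_extChartAt
  exact (h4.comp (e, e) h3).contDiffAt

end Adjoint

/-! ### The Lie bracket as the differential of the adjoint action. -/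

section Adjoint

variable {E : Type*} [NormedAddCommGroup E] [NormedSpace ℝ E]
  {G : Type*} [TopologicalSpace G] [ChartedSpace E G] [Group G] [LieGroup 𝓘(ℝ, E) ∞ G]

/-- Conjugation fixes the identity, so one chart serves at both ends. This reduces the
differentiability of the adjoint action at 1 to that of the first derivative of `chartConj`. -/
theorem eventually_adMap_eq : ∀ᶠ g in 𝓝 (1 : G), ∀ Y : E, adMap E g Y =
    fderiv ℝ (chartConj E G) (extChartAt 𝓘(ℝ, E) (1 : G) g, extChartAt 𝓘(ℝ, E) (1 : G) 1)
      (0, Y) := by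
  have hd : ∀ᶠ p in 𝓝 (extChartAt 𝓘(ℝ, E) (1 : G) 1, extChartAt 𝓘(ℝ, E) (1 : G) 1),
      DifferentiableAt ℝ (chartConj E G) p :=
    ((contDiffAt_chartConj.of_le (m := 1) ENat.LEInfty.out).eventually (by simp)).mono
      fun p hp => hp.differentiableAt (by simp)
  have hl : Tendsto (fun g : G => (extChartAt 𝓘(ℝ, E) (1 : G) g, extChartAt 𝓘(ℝ, E) (1 : G) 1))
      (𝓝 1) (𝓝 (extChartAt 𝓘(ℝ, E) (1 : G) 1, extChartAt 𝓘(ℝ, E) (1 : G) 1)) :=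
    ((continuousAt_extChartAt (1 : G)).prodMk continuousAt_const)
  filter_upwards [hl.eventually hd, extChartAt_source_mem_nhds (I := 𝓘(ℝ, E)) (1 : G)]
    with g hg hgs Y
  have h1 : adMap E g = fderiv ℝ (fun y => chartConj E G (extChartAt 𝓘(ℝ, E) (1 : G) g, y))
      (extChartAt 𝓘(ℝ, E) (1 : G) 1) := by
    unfold adMap
    rw [(mdifferentiable_conj g 1).mfderiv]
    have : (fun h : G => g * h * g⁻¹) 1 = 1 := by simp
    unfold writtenInExtChartAt
    rw [this, modelWithCornersSelf_coe, Set.range_id, fderivWithin_univ]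
    congr 1
    ext y
    simp only [chartConj, Function.comp_apply]
    rw [(extChartAt 𝓘(ℝ, E) (1 : G)).left_inv hgs]
  have h2 : HasFDerivAt (fun y => chartConj E G (extChartAt 𝓘(ℝ, E) (1 : G) g, y)) _ _ :=
    HasFDerivAt.comp (f := fun y : E => (extChartAt 𝓘(ℝ, E) (1 : G) g, y)) _ hg.hasFDerivAt
      (hasFDerivAt_prodMk_right _ _)
  rw [h1, h2.fderiv]
  simp

-- The manifold bracket is computed from fields pulled back to the chart; for left-invariant fields
-- these are partial derivatives of the local multiplication.
open VectorField in
theorem eventually_mpullback_mulInvariantVectorField (X : E) :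
    ∀ᶠ x in 𝓝 (extChartAt 𝓘(ℝ, E) (1 : G) 1),
    mpullbackWithin 𝓘(ℝ, E) 𝓘(ℝ, E) (extChartAt 𝓘(ℝ, E) (1 : G)).symm
      (mulInvariantVectorField (I := 𝓘(ℝ, E)) (X : GroupLieAlgebra 𝓘(ℝ, E) G))
      (Set.range 𝓘(ℝ, E)) x =
    fderiv ℝ (chartMul E G) (x, extChartAt 𝓘(ℝ, E) (1 : G) 1) (0, X) := by
  have : IsManifold 𝓘(ℝ, E) ∞ G := inferInstance
  have : IsManifold 𝓘(ℝ, E) 1 G := IsManifold.of_le (n := ∞) ENat.LEInfty.out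
  have hd : ∀ᶠ p in 𝓝 (extChartAt 𝓘(ℝ, E) (1 : G) 1, extChartAt 𝓘(ℝ, E) (1 : G) 1),
      DifferentiableAt ℝ (chartMul E G) p :=
    ((contDiffAt_chartMul.of_le (m := 1) ENat.LEInfty.out).eventually (by simp)).mono
      fun p hp => hp.differentiableAt (by simp)
  have hl : Tendsto (fun x : E => (x, extChartAt 𝓘(ℝ, E) (1 : G) 1))
      (𝓝 (extChartAt 𝓘(ℝ, E) (1 : G) 1))
      (𝓝 (extChartAt 𝓘(ℝ, E) (1 : G) 1, extChartAt 𝓘(ℝ, E) (1 : G) 1)) :=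
    (Continuous.prodMk_left _).continuousAt
  filter_upwards [hl.eventually hd, extChartAt_target_mem_nhds (I := 𝓘(ℝ, E)) (1 : G)]
    with x hx hxt
  set g := (extChartAt 𝓘(ℝ, E) (1 : G)).symm x with hg
  have hinv : (mfderivWithin 𝓘(ℝ, E) 𝓘(ℝ, E) (extChartAt 𝓘(ℝ, E) (1 : G)).symm
      (Set.range 𝓘(ℝ, E)) x).inverse = mfderiv 𝓘(ℝ, E) 𝓘(ℝ, E) (extChartAt 𝓘(ℝ, E) (1 : G)) g :=
    ContinuousLinearMap.inverse_eq
      (mfderivWithin_extChartAt_symm_comp_mfderiv_extChartAt hxt)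
      (mfderiv_extChartAt_comp_mfderivWithin_extChartAt_symm hxt)
  have hgs : g * 1 ∈ (chartAt E (1 : G)).source := by
    rw [mul_one, ← extChartAt_source (I := 𝓘(ℝ, E))]
    exact (extChartAt 𝓘(ℝ, E) (1 : G)).map_target hxt
  have d1 : MDifferentiableAt 𝓘(ℝ, E) 𝓘(ℝ, E) (extChartAt 𝓘(ℝ, E) (1 : G)) (g * 1) :=
    mdifferentiableAt_extChartAt hgs
  have d2 : MDifferentiableAt 𝓘(ℝ, E) 𝓘(ℝ, E) (fun h : G => g * h) 1 :=
    (contMDiff_mul_left (n := ∞) (a := g)).mdifferentiable (by simp) 1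
  have h3 := mfderiv_comp (I' := 𝓘(ℝ, E)) (1 : G) d1 d2
  have h4 : mfderiv 𝓘(ℝ, E) 𝓘(ℝ, E) ((extChartAt 𝓘(ℝ, E) (1 : G)) ∘ fun h : G => g * h) 1 =
      fderiv ℝ (fun y => chartMul E G (x, y)) (extChartAt 𝓘(ℝ, E) (1 : G) 1) := by
    rw [(MDifferentiableAt.comp (I' := 𝓘(ℝ, E)) (1 : G) d1 d2).mfderiv]
    unfold writtenInExtChartAt
    rw [modelWithCornersSelf_coe, Set.range_id, fderivWithin_univ]
    rfl
  have h2 : HasFDerivAt (fun y => chartMul E G (x, y)) _ _ :=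
    HasFDerivAt.comp (f := fun y : E => (x, y)) _ hx.hasFDerivAt
      (hasFDerivAt_prodMk_right _ _)
  have h5 : mpullbackWithin 𝓘(ℝ, E) 𝓘(ℝ, E) (extChartAt 𝓘(ℝ, E) (1 : G)).symm
      (mulInvariantVectorField (I := 𝓘(ℝ, E)) (X : GroupLieAlgebra 𝓘(ℝ, E) G))
      (Set.range 𝓘(ℝ, E)) x =
      mfderiv 𝓘(ℝ, E) 𝓘(ℝ, E) (extChartAt 𝓘(ℝ, E) (1 : G)) g
        (mulInvariantVectorField (I := 𝓘(ℝ, E)) (X : GroupLieAlgebra 𝓘(ℝ, E) G) g) := by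
    rw [mpullbackWithin, hinv]
    rfl
  rw [h5]
  have h6 : mfderiv 𝓘(ℝ, E) 𝓘(ℝ, E) (extChartAt 𝓘(ℝ, E) (1 : G)) g
        (mulInvariantVectorField (I := 𝓘(ℝ, E)) (X : GroupLieAlgebra 𝓘(ℝ, E) G) g) =
      mfderiv 𝓘(ℝ, E) 𝓘(ℝ, E) ((extChartAt 𝓘(ℝ, E) (1 : G)) ∘ fun h : G => g * h) 1 X := by
    rw [h3, mul_one]
    rfl
  rw [h6, h4, h2.fderiv]
  rfl

/-- These are the hypotheses of `fderiv_sub_fderiv_eq_of_conj`; the last one is `g h = (g h g⁻¹) g`.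
-/
theorem eventually_chart_identities :
    let e := extChartAt 𝓘(ℝ, E) (1 : G) 1
    (∀ᶠ x in 𝓝 e, chartMul E G (x, e) = x) ∧ (∀ᶠ x in 𝓝 e, chartConj E G (x, e) = e) ∧
    (∀ᶠ x in 𝓝 e, chartConj E G (e, x) = x) ∧
    ∀ᶠ p in 𝓝 (e, e), chartMul E G p = chartMul E G (chartConj E G p, p.1) := by
  intro e
  have ht := extChartAt_target_mem_nhds (I := 𝓘(ℝ, E)) (1 : G)
  have he : (extChartAt 𝓘(ℝ, E) (1 : G)).symm e = 1 := by simp [e]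
  refine ⟨?_, ?_, ?_, ?_⟩
  · filter_upwards [ht] with x hx
    simp only [chartMul, he, mul_one]
    exact (extChartAt 𝓘(ℝ, E) (1 : G)).right_inv hx
  · filter_upwards [ht] with x hx
    simp only [chartConj, he, mul_one, mul_inv_cancel, e]
  · filter_upwards [ht] with x hx
    simp only [chartConj, he, one_mul, inv_one, mul_one]
    exact (extChartAt 𝓘(ℝ, E) (1 : G)).right_inv hx
  · have hcont : ContinuousAt (fun p : E × E => (extChartAt 𝓘(ℝ, E) (1 : G)).symm p.1 *
        (extChartAt 𝓘(ℝ, E) (1 : G)).symm p.2 * ((extChartAt 𝓘(ℝ, E) (1 : G)).symm p.1)⁻¹)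
        (e, e) := by
      have := topologicalGroup_of_lieGroup 𝓘(ℝ, E) ∞ (G := G)
      have h0 : ContinuousAt (extChartAt 𝓘(ℝ, E) (1 : G)).symm e :=
        continuousAt_extChartAt_symm (1 : G)
      have h1 : ContinuousAt (fun p : E × E => (extChartAt 𝓘(ℝ, E) (1 : G)).symm p.1) (e, e) :=
        ContinuousAt.comp (x := (e, e)) (f := Prod.fst) h0 continuousAt_fst
      have h2 : ContinuousAt (fun p : E × E => (extChartAt 𝓘(ℝ, E) (1 : G)).symm p.2) (e, e) :=
        ContinuousAt.comp (x := (e, e)) (f := Prod.snd) h0 continuousAt_snd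
      exact (h1.mul h2).mul h1.inv
    have hs := extChartAt_source_mem_nhds (I := 𝓘(ℝ, E)) (1 : G)
    have hev := hcont.eventually (p := fun y => y ∈ (extChartAt 𝓘(ℝ, E) (1 : G)).source)
      (by simp only [he, mul_one, inv_one]; exact hs)
    filter_upwards [hev] with p hp
    simp only [chartMul, chartConj]
    rw [(extChartAt 𝓘(ℝ, E) (1 : G)).left_inv hp]
    congr 1
    group

theorem mdifferentiableAt_adMap_one :
    MDifferentiableAt 𝓘(ℝ, E) 𝓘(ℝ, E →L[ℝ] E) (fun g : G => adMap E g) 1 := by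
  have : IsManifold 𝓘(ℝ, E) ∞ G := inferInstance
  have : IsManifold 𝓘(ℝ, E) 1 G := IsManifold.of_le (n := ∞) ENat.LEInfty.out
  set e := extChartAt 𝓘(ℝ, E) (1 : G) 1 with he
  have hd : DifferentiableAt ℝ (fun x => (fderiv ℝ (chartConj E G) (x, e)).comp
      (ContinuousLinearMap.inr ℝ E E)) e := by
    have h1 : DifferentiableAt ℝ (fderiv ℝ (chartConj E G)) (e, e) :=
      (contDiffAt_chartConj.fderiv_right (m := 1) (by norm_cast)).differentiableAt (by simp)
    have h2 : HasFDerivAt (fun x : E => (x, e)) (ContinuousLinearMap.inl ℝ E E) e :=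
      hasFDerivAt_prodMk_left e e
    exact ((HasFDerivAt.comp (f := fun x : E => (x, e)) e h1.hasFDerivAt h2).clm_comp
      (hasFDerivAt_const (ContinuousLinearMap.inr ℝ E E) e)).differentiableAt
  have h1 := mdifferentiableAt_extChartAt (I := 𝓘(ℝ, E)) (x := (1 : G))
    (mem_chart_source E (1 : G))
  refine MDifferentiableAt.congr_of_eventuallyEq
    (MDifferentiableAt.comp (I' := 𝓘(ℝ, E)) (1 : G) hd.mdifferentiableAt h1) ?_
  filter_upwards [eventually_adMap_eq (E := E) (G := G)] with g hg
  ext Y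
  rw [hg]
  rfl

theorem hasMFDerivAt_adMap_apply (Y : E) :
    HasMFDerivAt 𝓘(ℝ, E) 𝓘(ℝ, E) (fun g : G => adMap E g Y) 1
      (fderiv ℝ (fun x => fderiv ℝ (chartConj E G) (x, extChartAt 𝓘(ℝ, E) (1 : G) 1) (0, Y))
        (extChartAt 𝓘(ℝ, E) (1 : G) 1)) := by
  have : IsManifold 𝓘(ℝ, E) ∞ G := inferInstance
  have : IsManifold 𝓘(ℝ, E) 1 G := IsManifold.of_le (n := ∞) ENat.LEInfty.out
  set e := extChartAt 𝓘(ℝ, E) (1 : G) 1 with he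
  have hd : DifferentiableAt ℝ (fun x => fderiv ℝ (chartConj E G) (x, e) (0, Y)) e := by
    have h1 : DifferentiableAt ℝ (fderiv ℝ (chartConj E G)) (e, e) :=
      (contDiffAt_chartConj.fderiv_right (m := 1) (by norm_cast)).differentiableAt (by simp)
    have h2 : HasFDerivAt (fun x : E => (x, e)) (ContinuousLinearMap.inl ℝ E E) e :=
      hasFDerivAt_prodMk_left e e
    exact ((HasFDerivAt.comp (f := fun x : E => (x, e)) e h1.hasFDerivAt h2).clm_apply
      (hasFDerivAt_const ((0 : E), Y) e)).differentiableAt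
  have h1 := (mdifferentiableAt_extChartAt (I := 𝓘(ℝ, E)) (x := (1 : G))
    (mem_chart_source E (1 : G))).hasMFDerivAt
  rw [mfderiv_extChartAt_self] at h1
  have h2 := HasMFDerivAt.comp (1 : G) hd.hasFDerivAt.hasMFDerivAt h1
  refine HasMFDerivAt.congr_of_eventuallyEq h2 ?_
  filter_upwards [eventually_adMap_eq (E := E) (G := G)] with g hg
  rw [hg]
  rfl

theorem fderiv_chartMul_inr (Z : E) :
    fderiv ℝ (chartMul E G) (extChartAt 𝓘(ℝ, E) (1 : G) 1, extChartAt 𝓘(ℝ, E) (1 : G) 1) (0, Z)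
      = Z := by
  set e := extChartAt 𝓘(ℝ, E) (1 : G) 1 with he
  have hd : DifferentiableAt ℝ (chartMul E G) (e, e) :=
    contDiffAt_chartMul.differentiableAt (by simp)
  have h1 : HasFDerivAt (fun y => chartMul E G (e, y)) _ e :=
    HasFDerivAt.comp (f := fun y : E => (e, y)) e hd.hasFDerivAt (hasFDerivAt_prodMk_right e e)
  have h2 : (fun y => y) =ᶠ[𝓝 e] (fun y => chartMul E G (e, y)) := by
    filter_upwards [extChartAt_target_mem_nhds (I := 𝓘(ℝ, E)) (1 : G)] with x hx
    simp only [chartMul, he, extChartAt_to_inv, one_mul]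
    exact ((extChartAt 𝓘(ℝ, E) (1 : G)).right_inv hx).symm
  have h3 := (h1.congr_of_eventuallyEq h2).unique (hasFDerivAt_id e)
  simpa using congrArg (fun f => f Z) h3

/-- The bracket of the Lie algebra of `G`, read in the model space. -/
noncomputable def groupBracket (G : Type*) [TopologicalSpace G] [ChartedSpace E G] [Group G]
    (X Y : E) : E :=
  (⁅(show GroupLieAlgebra 𝓘(ℝ, E) G from X), (show GroupLieAlgebra 𝓘(ℝ, E) G from Y)⁆ :
    GroupLieAlgebra 𝓘(ℝ, E) G)

open VectorField in
/-- The differential of the adjoint action is the Lie bracket. -/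
theorem derivOne_adMap_apply (X Y : E) :
    derivOne (fun g : G => adMap E g Y) X = groupBracket G X Y := by
  have : IsManifold 𝓘(ℝ, E) ∞ G := inferInstance
  have : IsManifold 𝓘(ℝ, E) 1 G := IsManifold.of_le (n := ∞) ENat.LEInfty.out
  obtain ⟨h1, h2, h3, h4⟩ := eventually_chart_identities (E := E) (G := G)
  have key := fderiv_sub_fderiv_eq_of_conj contDiffAt_chartMul contDiffAt_chartConj h1 h2 h3 h4 X Y
  unfold derivOne
  rw [(hasMFDerivAt_adMap_apply Y).mfderiv]
  refine key.symm.trans ?_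
  unfold groupBracket
  rw [GroupLieAlgebra.bracket_def, ← mlieBracketWithin_univ, mlieBracketWithin_apply,
    mfderiv_extChartAt_self]
  have eX := eventually_mpullback_mulInvariantVectorField (G := G) X
  have eY := eventually_mpullback_mulInvariantVectorField (G := G) Y
  rw [modelWithCornersSelf_coe, Set.range_id] at *
  rw [Set.preimage_univ, Set.univ_inter]
  have hL := Filter.EventuallyEq.lieBracket_vectorField_eq (𝕜 := ℝ) eX eY
  refine Eq.trans ?_ (congrArg (fun u : E => (ContinuousLinearMap.id ℝ E).inverse u) ((congrFun lieBracketWithin_univ _).trans hL).symm)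
  rw [ContinuousLinearMap.inverse_id, ContinuousLinearMap.id_apply]
  unfold lieBracket
  beta_reduce
  rw [fderiv_chartMul_inr, fderiv_chartMul_inr]

end Adjoint

/-! ### Differentials of homomorphisms, and passage from algebra to group. -/

section DerivOne

variable {E : Type*} [NormedAddCommGroup E] [NormedSpace ℝ E]
  {G : Type*} [TopologicalSpace G] [ChartedSpace E G] [Group G]
  {W W' : Type*} [NormedAddCommGroup W] [NormedSpace ℝ W]
  [NormedAddCommGroup W'] [NormedSpace ℝ W']
  {A : Type*} [NormedRing A] [NormedAlgebra ℝ A]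

/-- Differentiability at the identity of a map from a Lie group to a vector space. -/
abbrev MDiffOne (E : Type*) [NormedAddCommGroup E] [NormedSpace ℝ E]
    {G : Type*} [TopologicalSpace G] [ChartedSpace E G] [Group G]
    {W : Type*} [NormedAddCommGroup W] [NormedSpace ℝ W] (f : G → W) : Prop :=
  MDifferentiableAt 𝓘(ℝ, E) 𝓘(ℝ, W) f 1

theorem MDiffOne.hasMFDerivAt {f : G → W} (hf : MDiffOne E f) :
    HasMFDerivAt 𝓘(ℝ, E) 𝓘(ℝ, W) f 1 (derivOne (E := E) (W := W) f) :=
  MDifferentiableAt.hasMFDerivAt hf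

theorem derivOne_eq_of_hasMFDerivAt {f : G → W} {f' : E →L[ℝ] W}
    (hf : HasMFDerivAt 𝓘(ℝ, E) 𝓘(ℝ, W) f 1 f') : derivOne (E := E) f = f' :=
  hf.mfderiv

theorem derivOne_const (w : W) : derivOne (E := E) (fun _ : G => w) = 0 :=
  mfderiv_const

theorem MDiffOne.hasMFDerivAt_clm {f : G → W} (hf : MDiffOne E f) (L : W →L[ℝ] W') :
    HasMFDerivAt 𝓘(ℝ, E) 𝓘(ℝ, W') (fun g => L (f g)) 1 (L.comp (derivOne (E := E) f)) :=
  HasMFDerivAt.comp (1 : G) L.hasMFDerivAt hf.hasMFDerivAt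

theorem MDiffOne.clm {f : G → W} (hf : MDiffOne E f) (L : W →L[ℝ] W') :
    MDiffOne E (fun g => L (f g)) :=
  (hf.hasMFDerivAt_clm L).mdifferentiableAt

theorem MDiffOne.derivOne_clm {f : G → W} (hf : MDiffOne E f) (L : W →L[ℝ] W') (X : E) :
    derivOne (fun g => L (f g)) X = L (derivOne f X) := by
  rw [derivOne_eq_of_hasMFDerivAt (hf.hasMFDerivAt_clm L)]
  rfl

theorem MDiffOne.hasMFDerivAt_mul {f f' : G → A} (hf : MDiffOne E f) (hf' : MDiffOne E f') :
    HasMFDerivAt 𝓘(ℝ, E) 𝓘(ℝ, A) (fun g => f g * f' g) 1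
      (f 1 • derivOne (E := E) f' + MulOpposite.op (f' 1) • derivOne (E := E) f) :=
  HasMFDerivAt.mul' hf.hasMFDerivAt hf'.hasMFDerivAt

theorem MDiffOne.mul {f f' : G → A} (hf : MDiffOne E f) (hf' : MDiffOne E f') :
    MDiffOne E (fun g => f g * f' g) :=
  (hf.hasMFDerivAt_mul hf').mdifferentiableAt

theorem MDiffOne.derivOne_mul {f f' : G → A} (hf : MDiffOne E f) (hf' : MDiffOne E f') (X : E) :
    derivOne (fun g => f g * f' g) X = f 1 * derivOne f' X + derivOne f X * f' 1 := by
  rw [derivOne_eq_of_hasMFDerivAt (hf.hasMFDerivAt_mul hf')]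
  rfl

theorem mfderiv_eq_id_of_eq_id {f : G → G} (hf : f = id) :
    (show E →L[ℝ] E from mfderiv 𝓘(ℝ, E) 𝓘(ℝ, E) f 1) = ContinuousLinearMap.id ℝ E := by
  subst hf
  exact mfderiv_id

theorem adMap_one : adMap E (1 : G) = 1 := by
  exact mfderiv_eq_id_of_eq_id (by ext; simp)

variable [LieGroup 𝓘(ℝ, E) ∞ G]

theorem mdiffOne_inv (ρ : G →* A) (hρ : MDiffOne E ρ) : MDiffOne E (fun g => ρ g⁻¹) := by
  have h1 : MDifferentiableAt 𝓘(ℝ, E) 𝓘(ℝ, E) (fun g : G => g⁻¹) 1 :=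
    (contMDiff_inv 𝓘(ℝ, E) ∞).mdifferentiable (by simp) 1
  have h2 : MDifferentiableAt 𝓘(ℝ, E) 𝓘(ℝ, A) ρ ((fun g : G => g⁻¹) 1) := by
    simpa using hρ
  exact MDifferentiableAt.comp (I' := 𝓘(ℝ, E)) (1 : G) h2 h1

theorem derivOne_inv (ρ : G →* A) (hρ : MDiffOne E ρ) (X : E) :
    derivOne (fun g => ρ g⁻¹) X = - derivOne ρ X := by
  have h := hρ.derivOne_mul (mdiffOne_inv ρ hρ) X
  have h1 : (fun g => ρ g * ρ g⁻¹) = fun _ => 1 := by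
    ext g
    rw [← map_mul, mul_inv_cancel, map_one]
  rw [h1, derivOne_const] at h
  simp only [inv_one, map_one, one_mul, mul_one, zero_apply] at h
  exact eq_neg_of_add_eq_zero_left h.symm

theorem derivOne_adMap (ρ : G →* A) (hρ : MDiffOne E ρ) (g : G) (X : E) :
    derivOne ρ (adMap E g X) = ρ g * derivOne ρ X * ρ g⁻¹ := by
  have e1 : (fun h : G => g * h * g⁻¹) 1 = 1 := by simp
  have h2 : MDifferentiableAt 𝓘(ℝ, E) 𝓘(ℝ, A) ρ ((fun h : G => g * h * g⁻¹) 1) := by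
    rw [e1]; exact hρ
  have h3 := mfderiv_comp (I' := 𝓘(ℝ, E)) (1 : G) h2 (mdifferentiable_conj g 1)
  rw [show g * 1 * g⁻¹ = 1 by simp] at h3
  have h4 : derivOne (E := E) (ρ ∘ fun h : G => g * h * g⁻¹) X = derivOne ρ (adMap E g X) :=
    congrArg (fun f : E →L[ℝ] A => f X) h3
  rw [← h4]
  have h5 := MDiffOne.derivOne_clm hρ
    ((ContinuousLinearMap.mul ℝ A).flip (ρ g⁻¹) ∘L (ContinuousLinearMap.mul ℝ A (ρ g))) X
  refine Eq.trans ?_ h5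
  congr 1
  congr 1
  ext h
  simp

theorem adMap_mul (g h : G) : adMap E (g * h) = adMap E g * adMap E h := by
  have h2 : MDifferentiableAt 𝓘(ℝ, E) 𝓘(ℝ, E) (fun k : G => g * k * g⁻¹)
    ((fun k : G => h * k * h⁻¹) 1) := mdifferentiable_conj g _
  have h3 := mfderiv_comp (I' := 𝓘(ℝ, E)) (1 : G) h2 (mdifferentiable_conj h 1)
  rw [show h * 1 * h⁻¹ = 1 by simp] at h3
  have h4 : ((fun k : G => g * k * g⁻¹) ∘ fun k : G => h * k * h⁻¹) =
      fun k => (g * h) * k * (g * h)⁻¹ := by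
    ext k; simp only [Function.comp_apply]; group
  rw [h4] at h3
  exact h3

/-- The adjoint representation. -/
noncomputable def adHom (E : Type*) [NormedAddCommGroup E] [NormedSpace ℝ E]
    (G : Type*) [TopologicalSpace G] [ChartedSpace E G] [Group G] [LieGroup 𝓘(ℝ, E) ∞ G] :
    G →* (E →L[ℝ] E) where
  toFun g := adMap E g
  map_one' := adMap_one
  map_mul' := adMap_mul

theorem mdiffOne_adHom : MDiffOne E (adHom E G) := mdifferentiableAt_adMap_one

theorem derivOne_adHom (X Y : E) : derivOne (adHom E G) X Y = groupBracket G X Y := by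
  rw [← derivOne_adMap_apply]
  exact (MDiffOne.derivOne_clm (mdiffOne_adHom (G := G))
    (ContinuousLinearMap.apply ℝ E Y) X).symm

/-- The differential of a representation is a Lie algebra homomorphism. -/
theorem derivOne_groupBracket (ρ : G →* A) (hρ : MDiffOne E ρ) (X Y : E) :
    derivOne ρ (groupBracket G X Y) =
      derivOne ρ X * derivOne ρ Y - derivOne ρ Y * derivOne ρ X := by
  have h1 : derivOne (fun g : G => derivOne ρ (adHom E G g Y)) X =
      derivOne ρ (groupBracket G X Y) := by
    rw [← derivOne_adHom]
    exact MDiffOne.derivOne_clm (mdiffOne_adHom (G := G))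
      ((derivOne ρ) ∘L (ContinuousLinearMap.apply ℝ E Y)) X
  have h2 : (fun g : G => derivOne ρ (adHom E G g Y)) = fun g => ρ g * derivOne ρ Y * ρ g⁻¹ := by
    ext g
    exact derivOne_adMap ρ hρ g Y
  have h3 : MDiffOne E (fun g => ρ g * derivOne ρ Y) :=
    hρ.clm ((ContinuousLinearMap.mul ℝ A).flip (derivOne ρ Y))
  have h4 : derivOne (fun g => ρ g * derivOne ρ Y) X = derivOne ρ X * derivOne ρ Y :=
    hρ.derivOne_clm ((ContinuousLinearMap.mul ℝ A).flip (derivOne ρ Y)) X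
  rw [← h1, h2, h3.derivOne_mul (mdiffOne_inv ρ hρ), derivOne_inv ρ hρ, h4]
  simp only [map_one, inv_one, one_mul, mul_one, mul_neg]
  abel

/-- Near `g`, `f` is `τ ∘ f` near 1 composed with left translation by `g⁻¹`. -/
theorem hasMFDerivAt_zero_of_translate {f : G → W} (hf : MDiffOne E f)
    (hf0 : derivOne (E := E) f = 0) (hτ : ∀ g, ∃ τ : W →L[ℝ] W, ∀ h, f (g * h) = τ (f h)) (g : G) :
    HasMFDerivAt 𝓘(ℝ, E) 𝓘(ℝ, W) f g 0 := by
  obtain ⟨τ, hτ⟩ := hτ g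
  have h1 : HasMFDerivAt 𝓘(ℝ, E) 𝓘(ℝ, W) (fun h => τ (f h)) (g⁻¹ * g) 0 := by
    rw [inv_mul_cancel]
    exact (hf.hasMFDerivAt_clm τ).congr_mfderiv (by rw [hf0]; exact ContinuousLinearMap.comp_zero τ)
  have h2 : MDifferentiableAt 𝓘(ℝ, E) 𝓘(ℝ, E) (fun h : G => g⁻¹ * h) g :=
    (contMDiff_mul_left (n := ∞) (a := g⁻¹)).mdifferentiable (by simp) g
  have h3 := HasMFDerivAt.comp g h1 h2.hasMFDerivAt
  have h4 : ((fun h => τ (f h)) ∘ fun h : G => g⁻¹ * h) = f := by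
    ext h
    simp [← hτ]
  rw [h4] at h3
  exact h3

theorem eventually_eq_of_hasMFDerivAt_zero {M : Type*} [TopologicalSpace M]
    [ChartedSpace E M] [IsManifold 𝓘(ℝ, E) 1 M] {f : M → W}
    (hf : ∀ g, HasMFDerivAt 𝓘(ℝ, E) 𝓘(ℝ, W) f g 0) (g : M) : ∀ᶠ h in 𝓝 g, f h = f g := by
  set φ := extChartAt 𝓘(ℝ, E) g with hφ
  obtain ⟨r, hr, hball⟩ := Metric.mem_nhds_iff.1 (extChartAt_target_mem_nhds (I := 𝓘(ℝ, E)) g)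
  have hd : ∀ x ∈ Metric.ball (φ g) r, HasFDerivAt (f ∘ φ.symm) (0 : E →L[ℝ] W) x := by
    intro x hx
    have h1 : MDifferentiableAt 𝓘(ℝ, E) 𝓘(ℝ, E) φ.symm x :=
      ((contMDiffOn_extChartAt_symm (n := 1) g).contMDiffAt
        ((isOpen_extChartAt_target g).mem_nhds (hball hx))).mdifferentiableAt (by simp)
    have h2 := HasMFDerivAt.comp x (hf (φ.symm x)) h1.hasMFDerivAt
    rw [ContinuousLinearMap.zero_comp] at h2
    exact h2.hasFDerivAt
  have hconst : ∀ x ∈ Metric.ball (φ g) r, (f ∘ φ.symm) x = (f ∘ φ.symm) (φ g) := by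
    intro x hx
    refine (convex_ball (φ g) r).is_const_of_fderivWithin_eq_zero (𝕜 := ℝ)
      (fun y hy => (hd y hy).differentiableAt.differentiableWithinAt) (fun y hy => ?_) hx
      (Metric.mem_ball_self hr)
    rw [fderivWithin_of_isOpen Metric.isOpen_ball hy, (hd y hy).fderiv]
  have h3 : ∀ᶠ h in 𝓝 g, φ h ∈ Metric.ball (φ g) r :=
    (continuousAt_extChartAt g).eventually (Metric.ball_mem_nhds _ hr)
  filter_upwards [h3, extChartAt_source_mem_nhds (I := 𝓘(ℝ, E)) g] with h hh hs
  have := hconst _ hh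
  have e : φ.symm (φ h) = h := φ.left_inv hs
  rw [Function.comp_apply, Function.comp_apply, e] at this
  rw [this, hφ, extChartAt_to_inv]

theorem eq_of_derivOne_eq_zero [PreconnectedSpace G] {f : G → W} (hf : MDiffOne E f)
    (hf0 : derivOne (E := E) f = 0) (hτ : ∀ g, ∃ τ : W →L[ℝ] W, ∀ h, f (g * h) = τ (f h)) (g : G) :
    f g = f 1 := by
  have : IsManifold 𝓘(ℝ, E) ∞ G := inferInstance
  have : IsManifold 𝓘(ℝ, E) 1 G := IsManifold.of_le (n := ∞) ENat.LEInfty.out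
  have h := eventually_eq_of_hasMFDerivAt_zero (hasMFDerivAt_zero_of_translate hf hf0 hτ)
  exact ((IsLocallyConstant.iff_eventually_eq f).2 h).apply_eq_of_preconnectedSpace g 1

/-- The function `ρ g * P * ρ g⁻¹` is equivariant under translation, and its differential at 1 is
the commutator of `derivOne ρ X` with `P`, which vanishes; so it is constant. This replaces the
exponential map. -/
theorem commute_of_commute_derivOne [PreconnectedSpace G] (ρ : G →* A) (hρ : MDiffOne E ρ) {P : A}
    (hP : ∀ X : E, derivOne ρ X * P = P * derivOne ρ X) (g : G) : ρ g * P = P * ρ g := by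
  have h1 : MDiffOne E (fun g => ρ g * P) := hρ.clm ((ContinuousLinearMap.mul ℝ A).flip P)
  have h2 (X : E) : derivOne (fun g => ρ g * P) X = derivOne ρ X * P :=
    hρ.derivOne_clm ((ContinuousLinearMap.mul ℝ A).flip P) X
  have h3 := eq_of_derivOne_eq_zero (h1.mul (mdiffOne_inv ρ hρ)) (by
    ext X
    rw [h1.derivOne_mul (mdiffOne_inv ρ hρ), derivOne_inv ρ hρ, h2, hP]
    simp) (fun g => ⟨(ContinuousLinearMap.mul ℝ A).flip (ρ g⁻¹) ∘L
      (ContinuousLinearMap.mul ℝ A (ρ g)), fun h => by simp [mul_assoc]⟩) g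
  simp only [map_one, one_mul, inv_one, mul_one] at h3
  calc ρ g * P = ρ g * P * (ρ g⁻¹ * ρ g) := by rw [← map_mul]; simp
    _ = P * ρ g := by rw [← mul_assoc, h3]

theorem mdifferentiableAt_of_mdiffOne (ρ : G →* A) (hρ : MDiffOne E ρ) (g : G) :
    MDifferentiableAt 𝓘(ℝ, E) 𝓘(ℝ, A) ρ g := by
  have h1 : MDifferentiableAt 𝓘(ℝ, E) 𝓘(ℝ, A) (fun h => ρ g * ρ h) (g⁻¹ * g) := by
    rw [inv_mul_cancel]
    exact hρ.clm (ContinuousLinearMap.mul ℝ A (ρ g))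
  have h2 : MDifferentiableAt 𝓘(ℝ, E) 𝓘(ℝ, E) (fun h : G => g⁻¹ * h) g :=
    (contMDiff_mul_left (n := ∞) (a := g⁻¹)).mdifferentiable (by simp) g
  have h3 := MDifferentiableAt.comp (I' := 𝓘(ℝ, E)) g h1 h2
  have h4 : ((fun h => ρ g * ρ h) ∘ fun h : G => g⁻¹ * h) = ρ := by
    ext h
    simp only [Function.comp_apply, ← map_mul, mul_inv_cancel_left]
  rw [h4] at h3
  exact h3

theorem continuous_of_mdiffOne (ρ : G →* A) (hρ : MDiffOne E ρ) : Continuous ρ :=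
  continuous_iff_continuousAt.2 fun g => (mdifferentiableAt_of_mdiffOne ρ hρ g).continuousAt

theorem mfderiv_mulInvariantVectorField (ρ : G →* A) (hρ : MDiffOne E ρ) (g : G) (X : E) :
    (mfderiv 𝓘(ℝ, E) 𝓘(ℝ, A) ρ g
      (mulInvariantVectorField (I := 𝓘(ℝ, E)) (X : GroupLieAlgebra 𝓘(ℝ, E) G) g) : A) =
      ρ g * derivOne ρ X := by
  have h1 : MDifferentiableAt 𝓘(ℝ, E) 𝓘(ℝ, A) ρ ((fun h : G => g * h) 1) :=
    mdifferentiableAt_of_mdiffOne ρ hρ _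
  have h2 : MDifferentiableAt 𝓘(ℝ, E) 𝓘(ℝ, E) (fun h : G => g * h) 1 :=
    (contMDiff_mul_left (n := ∞) (a := g)).mdifferentiable (by simp) 1
  have h3 := mfderiv_comp (I' := 𝓘(ℝ, E)) (1 : G) h1 h2
  rw [mul_one] at h3
  have h4 : derivOne (E := E) (ρ ∘ fun h : G => g * h) X = ρ g * derivOne ρ X := by
    have := hρ.derivOne_clm (ContinuousLinearMap.mul ℝ A (ρ g)) X
    refine Eq.trans ?_ this
    congr 2
    ext h
    simp
  rw [← h4]
  exact (congrArg (fun f : E →L[ℝ] A => f X) h3).symm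

/-- If the differential of a representation has a kernel, then so does the representation. -/
theorem exists_ne_one_map_eq_one [CompleteSpace E] (ρ : G →* A) (hρ : MDiffOne E ρ)
    {X : E} (hX : X ≠ 0) (hX0 : derivOne ρ X = 0) : ∃ g : G, g ≠ 1 ∧ ρ g = 1 := by
  have : IsManifold 𝓘(ℝ, E) ∞ G := inferInstance
  have : IsManifold 𝓘(ℝ, E) 1 G := IsManifold.of_le (n := ∞) ENat.LEInfty.out
  have hv := (contMDiffAt_mulInvariantVectorField (I := 𝓘(ℝ, E))
    (X : GroupLieAlgebra 𝓘(ℝ, E) G) (g := (1 : G))).of_le (m := 1) (by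
      rw [minSmoothness_of_isRCLikeNormedField]; norm_num)
  -- Along the integral curve of the left-invariant field of `X`, the derivative of `ρ ∘ γ` is `ρ (γ
  -- t) * derivOne ρ X = 0`. If only 1 were mapped to 1, `γ` would stay at 1 near time 0 and its
  -- velocity `X` would vanish.
  obtain ⟨γ, hγ0, hγ⟩ := exists_isMIntegralCurveAt_of_contMDiffAt_boundaryless 0 hv
  by_contra! hcon
  have hd : ∀ᶠ t in 𝓝 (0 : ℝ), HasDerivAt (fun t => ρ (γ t)) 0 t := by
    filter_upwards [hγ] with t ht
    have h1 := HasMFDerivAt.comp t (mdifferentiableAt_of_mdiffOne ρ hρ (γ t)).hasMFDerivAt ht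
    have h2 : HasFDerivAt (fun t => ρ (γ t)) (0 : ℝ →L[ℝ] A) t := by
      refine HasMFDerivAt.hasFDerivAt (h1.congr_mfderiv ?_)
      refine ContinuousLinearMap.ext fun s => ?_
      have h3 := mfderiv_mulInvariantVectorField ρ hρ (γ t) X
      rw [hX0, mul_zero] at h3
      have h4 := congrArg (fun a : A => (show ℝ from s) • a) h3
      refine Eq.trans ?_ (h4.trans (smul_zero (show ℝ from s)))
      exact map_smul (show E →L[ℝ] A from mfderiv 𝓘(ℝ, E) 𝓘(ℝ, A) ρ (γ t)) (show ℝ from s)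
        (show E from mulInvariantVectorField (I := 𝓘(ℝ, E)) (X : GroupLieAlgebra 𝓘(ℝ, E) G) (γ t))
    exact h2.hasDerivAt
  obtain ⟨r, hr, hball⟩ := Metric.eventually_nhds_iff_ball.1 hd
  have hone : ∀ᶠ t in 𝓝 (0 : ℝ), γ t = 1 := by
    filter_upwards [Metric.ball_mem_nhds (0 : ℝ) hr] with t ht
    by_contra hne
    refine hcon _ hne ?_
    have h1 : ρ (γ t) = ρ (γ 0) := by
      refine (convex_ball (0 : ℝ) r).is_const_of_fderivWithin_eq_zero (𝕜 := ℝ)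
        (f := fun t => ρ (γ t))
        (fun y hy => (hball y hy).differentiableAt.differentiableWithinAt) (fun y hy => ?_) ht
        (Metric.mem_ball_self hr)
      rw [fderivWithin_of_isOpen Metric.isOpen_ball hy, (hball y hy).hasFDerivAt.fderiv]
      simp
    rw [h1, hγ0, map_one]
  have h1 := hγ.hasMFDerivAt
  have h2 : HasMFDerivAt 𝓘(ℝ, ℝ) 𝓘(ℝ, E) γ 0 0 :=
    (hasMFDerivAt_const (1 : G) (0 : ℝ)).congr_of_eventuallyEq hone
  have h3 := hasMFDerivAt_unique h1 h2
  have h4 : (mulInvariantVectorField (I := 𝓘(ℝ, E)) (X : GroupLieAlgebra 𝓘(ℝ, E) G) (γ 0) : E)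
      = 0 := by
    have := congrArg (fun f : ℝ →L[ℝ] E => f 1) h3
    exact (one_smul ℝ _).symm.trans this
  rw [hγ0] at h4
  refine hX (Eq.trans ?_ h4)
  have h5 := mfderiv_eq_id_of_eq_id (E := E) (f := fun h : G => 1 * h) (by ext; simp)
  exact (congrArg (fun f : E →L[ℝ] E => f X) h5).symm

end DerivOne

/-! ### Spectra of operators in irreducible families. -/

section Eigenvalues

variable {U : Type*} [AddCommGroup U] [Module ℂ U]

/-- Otherwise `(X - μ) ^ k` and `p` are coprime, and a Bézout relation kills `v`. -/
theorem isRoot_of_pow_sub_apply_eq_zero {V : Type*} [AddCommGroup V] [Module ℂ V]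
    {D : Module.End ℂ V} {p : Polynomial ℂ} {μ : ℂ} {k : ℕ} {v : V} (hv : v ≠ 0)
    (h1 : ((D - μ • 1) ^ k) v = 0)
    (h2 : Polynomial.aeval D p v = 0) : p.IsRoot μ := by
  by_contra hroot
  have hco : IsCoprime ((Polynomial.X - Polynomial.C μ) ^ k) p :=
    (((Polynomial.irreducible_X_sub_C μ).coprime_iff_not_dvd).2
      fun h => hroot (Polynomial.dvd_iff_isRoot.1 h)).pow_left
  obtain ⟨a, b, hab⟩ := hco
  have h3 := congrArg (fun q => Polynomial.aeval D q v) hab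
  simp only [map_add, map_mul, map_pow, map_sub, Polynomial.aeval_X, Polynomial.aeval_C, map_one,
    Algebra.algebraMap_eq_smul_one,
    LinearMap.add_apply, Module.End.mul_apply, h1, h2, map_zero, add_zero,
    Module.End.one_apply] at h3
  exact hv h3.symm

/-- The operator `T ↦ A T - T A`. -/
noncomputable def commutatorMap (A : Module.End ℂ U) : Module.End ℂ (Module.End ℂ U) :=
  LinearMap.mulLeft ℂ A - LinearMap.mulRight ℂ A

theorem mem_maxGenEigenspace_of_sub_apply_mem {V : Type*} [AddCommGroup V] [Module ℂ V]
    {A : Module.End ℂ V} {c : ℂ} {v : V}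
    (h : (A - c • 1) v ∈ A.maxGenEigenspace c) :
    v ∈ A.maxGenEigenspace c := by
  obtain ⟨k, hk⟩ := (Module.End.mem_maxGenEigenspace A c _).1 h
  refine (Module.End.mem_maxGenEigenspace A c _).2 ⟨k + 1, ?_⟩
  rw [pow_succ]
  exact hk

/-- Follows by induction on `k + m` from `(A - (μ + c)) T v = ((commutatorMap A - μ) T) v + T ((A -
c) v)`. -/
theorem apply_mem_maxGenEigenspace {A : Module.End ℂ U} {μ c : ℂ} (n : ℕ) :
    ∀ (k m : ℕ) (T : Module.End ℂ U) (v : U), k + m ≤ n →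
      ((commutatorMap A - μ • 1) ^ k) T = 0 →
      ((A - c • 1) ^ m) v = 0 →
      T v ∈ A.maxGenEigenspace (μ + c) := by
  induction n with
  | zero =>
    intro k m T v hkm hT hv
    obtain rfl : k = 0 := by omega
    simp at hT
    simp [hT]
  | succ n ih =>
    intro k m T v hkm hT hv
    rcases k with _ | k
    · simp at hT
      simp [hT]
    rcases m with _ | m
    · simp at hv
      simp [hv]
    refine mem_maxGenEigenspace_of_sub_apply_mem ?_
    have h1 := ih k (m + 1) ((commutatorMap A - μ • 1) T) v (by omega)
      (by rw [pow_succ] at hT; exact hT) hv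
    have h2 := ih (k + 1) m T ((A - c • 1) v) (by omega) hT
      (by rw [pow_succ] at hv; exact hv)
    convert! Submodule.add_mem _ h1 h2 using 1
    simp [commutatorMap, add_smul]
    abel

theorem hasEigenvalue_of_maxGenEigenspace_ne_bot {A : Module.End ℂ U} {z : ℂ}
    (hz : A.maxGenEigenspace z ≠ ⊥) : A.HasEigenvalue z :=
  Module.End.HasUnifEigenvalue.lt (k := ⊤) zero_lt_one hz

theorem exists_mem_biSup_maxGenEigenspace {A : Module.End ℂ U} {c : ℂ} (hc : A.HasEigenvalue c)
    {C : Set ℂ} (hcC : c ∈ C) : ∃ v ≠ 0, v ∈ ⨆ z ∈ C, A.maxGenEigenspace z := by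
  obtain ⟨v, hv⟩ := hc.exists_hasEigenvector
  refine ⟨v, hv.2, ?_⟩
  have h : A.maxGenEigenspace c ≤ ⨆ z ∈ C, A.maxGenEigenspace z :=
    le_iSup₂_of_le (f := fun z (_ : z ∈ C) => A.maxGenEigenspace z) c hcC le_rfl
  exact h ((A.genEigenspace c).monotone le_top hv.1)

variable [FiniteDimensional ℂ U]

/-- Inside the kernel of `p (commutatorMap A)`, `T` is a sum of generalized eigenvectors of
`commutatorMap A`. Their eigenvalues are roots of `p`, so each summand shifts by at most `R`. -/
theorem apply_mem_iSup_maxGenEigenspace {A T : Module.End ℂ U} {p : Polynomial ℂ} {R : ℝ}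
    (hp : ∀ μ, p.IsRoot μ → ‖μ‖ ≤ R)
    (hT : Polynomial.aeval (commutatorMap A) p T = 0)
    {c : ℂ} {v : U} (hv : v ∈ A.maxGenEigenspace c) :
    T v ∈ ⨆ μ : ℂ, ⨆ _ : ‖μ‖ ≤ R, A.maxGenEigenspace (μ + c) := by
  set D : Module.End ℂ (Module.End ℂ U) := commutatorMap A with hD
  set W : Submodule ℂ (Module.End ℂ U) := LinearMap.ker (Polynomial.aeval D p) with hW
  have hWinv : ∀ x ∈ W, D x ∈ W := by
    intro x hx
    rw [hW, LinearMap.mem_ker] at hx ⊢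
    have hcomm : Polynomial.aeval D p * D = D * Polynomial.aeval D p := by
      have := congrArg (Polynomial.aeval D) (mul_comm p Polynomial.X)
      simpa using this
    have := congrArg (fun f => f x) hcomm
    simp only [Module.End.mul_apply, hx, map_zero] at this
    exact this
  have hmem : T ∈ ⨆ μ, W ⊓ D.genEigenspace μ ⊤ := by
    rw [← Submodule.eq_iSup_inf_genEigenspace ⊤ hWinv (Module.End.iSup_maxGenEigenspace_eq_top D)]
    exact LinearMap.mem_ker.2 hT
  clear hT
  induction hmem using Submodule.iSup_induction' with
  | mem μ x hx =>
    by_cases hx0 : x = 0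
    · simp [hx0]
    · obtain ⟨k, hk⟩ := (Module.End.mem_maxGenEigenspace D μ x).1 hx.2
      have hroot := isRoot_of_pow_sub_apply_eq_zero (D := D) hx0 hk hx.1
      obtain ⟨m, hm⟩ := (Module.End.mem_maxGenEigenspace A c v).1 hv
      exact Submodule.mem_iSup_of_mem μ (Submodule.mem_iSup_of_mem (hp μ hroot)
        (apply_mem_maxGenEigenspace (k + m) k m x v le_rfl hk hm))
  | zero => simp
  | add x y hx hy h1 h2 =>
    exact Submodule.add_mem _ h1 h2

theorem apply_mem_biSup_maxGenEigenspace {A T : Module.End ℂ U}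
    {p : Polynomial ℂ} {R : ℝ} (hp : ∀ μ, p.IsRoot μ → ‖μ‖ ≤ R)
    (hT : Polynomial.aeval (commutatorMap A) p T = 0) {K : Set ℂ}
    (hK : ∀ c c', A.HasEigenvalue c → A.HasEigenvalue c' → ‖c' - c‖ ≤ R → c ∈ K → c' ∈ K)
    {v : U} (hv : v ∈ ⨆ z ∈ K, A.maxGenEigenspace z) : T v ∈ ⨆ z ∈ K, A.maxGenEigenspace z := by
  suffices h : (⨆ z ∈ K, A.maxGenEigenspace z) ≤
      (⨆ z ∈ K, A.maxGenEigenspace z).comap T from h hv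
  refine iSup₂_le fun z hz w hw => ?_
  rw [Submodule.mem_comap]
  by_cases hw0 : w = 0
  · rw [hw0, map_zero]; exact zero_mem _
  have hzE : A.HasEigenvalue z := hasEigenvalue_of_maxGenEigenspace_ne_bot fun h => hw0 (by
    rw [h] at hw; exact (Submodule.mem_bot ℂ).1 hw)
  have hTw := apply_mem_iSup_maxGenEigenspace hp hT hw
  suffices h : (⨆ μ : ℂ, ⨆ _ : ‖μ‖ ≤ R, A.maxGenEigenspace (μ + z)) ≤
      ⨆ z ∈ K, A.maxGenEigenspace z from h hTw
  refine iSup₂_le fun μ hμ => ?_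
  by_cases hb : A.maxGenEigenspace (μ + z) = ⊥
  · rw [hb]; exact bot_le
  · exact le_iSup₂_of_le (f := fun z (_ : z ∈ K) => A.maxGenEigenspace z) (μ + z)
      (hK z _ hzE (hasEigenvalue_of_maxGenEigenspace_ne_bot hb) (by simpa using hμ) hz) le_rfl

theorem isCompl_biSup_maxGenEigenspace (A : Module.End ℂ U) (C : Set ℂ) :
    IsCompl (⨆ z ∈ C, A.maxGenEigenspace z) (⨆ z ∈ Cᶜ, A.maxGenEigenspace z) := by
  refine ⟨A.independent_maxGenEigenspace.disjoint_biSup_biSup disjoint_compl_right,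
    codisjoint_iff.2 (top_le_iff.1 ?_)⟩
  rw [← Module.End.iSup_maxGenEigenspace_eq_top A]
  refine iSup_le fun z => ?_
  by_cases hz : z ∈ C
  · exact (le_iSup₂_of_le (f := fun z (_ : z ∈ C) => A.maxGenEigenspace z) z hz le_rfl).trans
      le_sup_left
  · exact (le_iSup₂_of_le (f := fun z (_ : z ∈ Cᶜ) => A.maxGenEigenspace z) z hz le_rfl).trans
      le_sup_right

/-- Being within distance `R` is symmetric, so the complement of `C` is closed under such steps as
well. The two sums of generalized eigenspaces are invariant and complementary, hence one of them is
zero. -/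
theorem eigenvalue_mem_of_closed {A : Module.End ℂ U} {𝒯 : Set (Module.End ℂ U)}
    {p : Polynomial ℂ} {R : ℝ} (hp : ∀ μ, p.IsRoot μ → ‖μ‖ ≤ R)
    (hT : ∀ T ∈ 𝒯, Polynomial.aeval (commutatorMap A) p T = 0)
    (hirr : ∀ S S' : Submodule ℂ U, IsCompl S S' → (∀ T ∈ 𝒯, ∀ v ∈ S, T v ∈ S) →
      (∀ T ∈ 𝒯, ∀ v ∈ S', T v ∈ S') → S = ⊥ ∨ S = ⊤)
    {C : Set ℂ} (hC : ∀ c c', A.HasEigenvalue c → A.HasEigenvalue c' → ‖c' - c‖ ≤ R →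
      c ∈ C → c' ∈ C) {c c' : ℂ} (hc : A.HasEigenvalue c) (hc' : A.HasEigenvalue c')
    (hcC : c ∈ C) : c' ∈ C := by
  by_contra hcon
  have hcompl := isCompl_biSup_maxGenEigenspace A C
  obtain ⟨v, hv, hvS⟩ := exists_mem_biSup_maxGenEigenspace hc hcC
  obtain ⟨v', hv', hvS'⟩ := exists_mem_biSup_maxGenEigenspace (C := Cᶜ) hc' hcon
  have hC' : ∀ c c', A.HasEigenvalue c → A.HasEigenvalue c' → ‖c' - c‖ ≤ R → c ∈ Cᶜ → c' ∈ Cᶜ :=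
    fun z z' hz hz' hzz hzC hz'C => hzC (hC z' z hz' hz (by rwa [norm_sub_rev]) hz'C)
  rcases hirr _ _ hcompl (fun T hTT v hv => apply_mem_biSup_maxGenEigenspace hp (hT T hTT) hC hv)
    (fun T hTT v hv => apply_mem_biSup_maxGenEigenspace hp (hT T hTT) hC' hv) with h | h
  · rw [h] at hvS
    exact hv ((Submodule.mem_bot ℂ).1 hvS)
  · have hdisj := hcompl.disjoint
    rw [h, disjoint_comm, disjoint_top] at hdisj
    rw [hdisj] at hvS'
    exact hv' ((Submodule.mem_bot ℂ).1 hvS')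

theorem norm_sub_eigenvalue_le {A : Module.End ℂ U} {𝒯 : Set (Module.End ℂ U)}
    {p : Polynomial ℂ} {R : ℝ} (hR : 0 < R) (hp : ∀ μ, p.IsRoot μ → ‖μ‖ ≤ R)
    (hT : ∀ T ∈ 𝒯, Polynomial.aeval (commutatorMap A) p T = 0)
    (hirr : ∀ S S' : Submodule ℂ U, IsCompl S S' → (∀ T ∈ 𝒯, ∀ v ∈ S, T v ∈ S) →
      (∀ T ∈ 𝒯, ∀ v ∈ S', T v ∈ S') → S = ⊥ ∨ S = ⊤)
    {c c' : ℂ} (hc : A.HasEigenvalue c) (hc' : A.HasEigenvalue c') :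
    ‖c' - c‖ ≤ Module.finrank ℂ U * R := by
  set n := Module.finrank ℂ U with hn
  -- Cut the plane around `c` into annuli of width `R`. If one of the first `n` contains no
  -- eigenvalue, the disc inside it is closed under steps of length `R`, so it contains the whole
  -- spectrum.
  by_cases hgap : ∃ j < n, ∀ z, A.HasEigenvalue z → ‖z - c‖ ≤ (j + 1 : ℕ) * R → ‖z - c‖ ≤ j * R
  · obtain ⟨j, hj, hgap⟩ := hgap
    have := eigenvalue_mem_of_closed hp hT hirr (C := {z | ‖z - c‖ ≤ j * R})
      (fun z z' hz hz' hzz hzC => hgap z' hz' (by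
        have h1 : ‖z' - c‖ ≤ ‖z' - z‖ + ‖z - c‖ := by
          simpa using norm_add_le (z' - z) (z - c)
        have h2 : ‖z - c‖ ≤ j * R := hzC
        push_cast
        linarith)) hc hc' (by simp; positivity)
    refine le_trans this ?_
    gcongr
  · exfalso
    push Not at hgap
    set s := A.charpoly.roots.toFinset with hs
    have hmem (z : ℂ) : z ∈ s ↔ A.HasEigenvalue z := by
      rw [hs, Multiset.mem_toFinset, Polynomial.mem_roots (LinearMap.charpoly_monic A).ne_zero,
        Module.End.hasEigenvalue_iff_isRoot_charpoly]
    have hcard : s.card ≤ n := by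
      refine (Multiset.toFinset_card_le _).trans ((Polynomial.card_roots' _).trans ?_)
      rw [LinearMap.charpoly_natDegree]
    -- The ceiling numbers the annuli. The values `1, …, n` all occur, and `c` gives 0: one
    -- eigenvalue too many.
    have hsub : Finset.range (n + 1) ⊆ s.image (fun z => ⌈‖z - c‖ / R⌉₊) := by
      intro j hj
      rw [Finset.mem_image]
      rcases j with _ | j
      · exact ⟨c, (hmem c).2 hc, by simp⟩
      · obtain ⟨z, hz, h1, h2⟩ := hgap j (by simpa using hj)
        refine ⟨z, (hmem z).2 hz, ?_⟩
        rw [Nat.ceil_eq_iff (by simp)]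
        constructor
        · rw [lt_div_iff₀ hR]; simpa using h2
        · rw [div_le_iff₀ hR]; exact h1
    have := (Finset.card_le_card hsub).trans Finset.card_image_le
    simp at this
    omega

/-- An eigenvalue of a traceless operator generating, together with an irreducible family on which
its adjoint action has bounded spectrum, is bounded in terms of the dimension. -/
theorem norm_eigenvalue_le {A : Module.End ℂ U} {𝒯 : Set (Module.End ℂ U)}
    {p : Polynomial ℂ} {R : ℝ} (hR : 0 < R) (hp : ∀ μ, p.IsRoot μ → ‖μ‖ ≤ R)
    (hT : ∀ T ∈ 𝒯, Polynomial.aeval (commutatorMap A) p T = 0)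
    (hirr : ∀ S S' : Submodule ℂ U, IsCompl S S' → (∀ T ∈ 𝒯, ∀ v ∈ S, T v ∈ S) →
      (∀ T ∈ 𝒯, ∀ v ∈ S', T v ∈ S') → S = ⊥ ∨ S = ⊤)
    (htr : LinearMap.trace ℂ U A = 0) {c : ℂ} (hc : A.HasEigenvalue c) :
    ‖c‖ ≤ Module.finrank ℂ U * R := by
  set n := Module.finrank ℂ U with hn
  have hsplit : A.charpoly.Splits := IsAlgClosed.splits _
  have hsum : A.charpoly.roots.sum = 0 := by
    rw [← Module.End.trace_eq_sum_roots_charpoly_of_splits hsplit, htr]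
  have hcard : A.charpoly.roots.card = n := by
    rw [← hsplit.natDegree_eq_card_roots, LinearMap.charpoly_natDegree]
  have hbd : ∀ z ∈ A.charpoly.roots, ‖z - c‖ ≤ n * R := fun z hz =>
    norm_sub_eigenvalue_le hR hp hT hirr hc
      ((Module.End.hasEigenvalue_iff_isRoot_charpoly A z).2 (Polynomial.isRoot_of_mem_roots hz))
  -- With multiplicity the eigenvalues sum to the trace 0, so the mean of `z - c` is `-c`.
  have h1 : (A.charpoly.roots.map fun z => z - c).sum = -(n * c) := by
    rw [Multiset.sum_map_sub, Multiset.map_id', hsum, Multiset.map_const', Multiset.sum_replicate,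
      hcard]
    simp
  have h2 : ‖(n : ℂ) * c‖ ≤ n * (n * R) := by
    rw [← norm_neg, ← h1]
    refine (norm_multiset_sum_le _).trans ?_
    rw [Multiset.map_map]
    refine (Multiset.sum_le_card_nsmul _ (n * R) ?_).trans ?_
    · intro x hx
      obtain ⟨z, hz, rfl⟩ := Multiset.mem_map.1 hx
      exact hbd z hz
    · simp [hcard]
  obtain ⟨v, hv⟩ := hc.exists_hasEigenvector
  have : Nontrivial U := ⟨v, 0, hv.2⟩
  have hnpos : (0 : ℝ) < n := by exact_mod_cast Module.finrank_pos
  rw [norm_mul, Complex.norm_natCast] at h2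
  exact le_of_mul_le_mul_left h2 hnpos

end Eigenvalues

/-! ### Subquotients and tensor squares carrying a prescribed eigenvalue. -/

section Representations

/-- The compression of a representation along `π` and a section `ι`. -/
noncomputable def compressionHom {G : Type*} [Group G] {𝕜 V W : Type*} [NontriviallyNormedField 𝕜]
    [NormedAddCommGroup V] [NormedSpace 𝕜 V] [NormedAddCommGroup W] [NormedSpace 𝕜 W]
    (ρ : G →* (V →L[𝕜] V)) (π : V →L[𝕜] W) (ι : W →L[𝕜] V)
    (h : ∀ w, π (ι w) = w) (hmul : ∀ g g' w, π (ρ g (ι (π (ρ g' (ι w))))) = π (ρ g (ρ g' (ι w)))) :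
    G →* (W →L[𝕜] W) where
  toFun g := π ∘L ρ g ∘L ι
  map_one' := by ext w; simp [h]
  map_mul' g g' := by ext w; simp [hmul]

variable {E : Type*} [NormedAddCommGroup E] [NormedSpace ℝ E]
  {G : Type*} [TopologicalSpace G] [ChartedSpace E G] [Group G]
  {V W : Type*} [NormedAddCommGroup V] [NormedSpace ℂ V]
  [NormedAddCommGroup W] [NormedSpace ℂ W]

theorem derivOne_intertwine {ρ : G →* (V →L[ℂ] V)} {σ : G →* (W →L[ℂ] W)} (hρ : MDiffOne E ρ)
    (hσ : MDiffOne E σ) {T : V →L[ℂ] W} (hT : ∀ g, T ∘L ρ g = σ g ∘L T) (X : E) :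
    T ∘L derivOne ρ X = derivOne σ X ∘L T := by
  have h1 := hρ.derivOne_clm ((ContinuousLinearMap.compL ℂ V V W T).restrictScalars ℝ) X
  have h2 := hσ.derivOne_clm
    (((ContinuousLinearMap.compL ℂ V W W).flip T).restrictScalars ℝ) X
  have h3 : (fun g => (ContinuousLinearMap.compL ℂ V V W T).restrictScalars ℝ (ρ g)) =
      fun g => ((ContinuousLinearMap.compL ℂ V W W).flip T).restrictScalars ℝ (σ g) :=
    funext hT
  rw [h3] at h1
  exact h1.symm.trans h2

/-- A representation is differentiable, trivial at `g₀`, and has `c` as an eigenvalue of `X`. -/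
structure IsAdmissible (g₀ : G) (X : E) (c : ℂ) (ρ : G →* (V →L[ℂ] V)) : Prop where
  mdiffOne : MDiffOne E ρ
  map_eq_one : ρ g₀ = 1
  exists_eigenvector : ∃ v, v ≠ 0 ∧ derivOne ρ X v = c • v

theorem mdiffOne_compressionHom {ρ : G →* (V →L[ℂ] V)} (hρ : MDiffOne E ρ) {π : V →L[ℂ] W}
    {ι : W →L[ℂ] V} (h : ∀ w, π (ι w) = w)
    (hmul : ∀ g g' w, π (ρ g (ι (π (ρ g' (ι w))))) = π (ρ g (ρ g' (ι w)))) :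
    MDiffOne E (compressionHom ρ π ι h hmul) :=
  hρ.clm ((ContinuousLinearMap.compL ℂ W V W π ∘L
    (ContinuousLinearMap.compL ℂ W V V).flip ι).restrictScalars ℝ)

/-- Here `hι` encodes invariance of the range of `ι`; in `IsAdmissible.quotient`, `hπ` encodes
invariance of the kernel of `π`. -/
theorem IsAdmissible.sub {g₀ : G} {X : E} {c : ℂ} {ρ : G →* (V →L[ℂ] V)}
    (hρ : IsAdmissible g₀ X c ρ) {π : V →L[ℂ] W} {ι : W →L[ℂ] V} (h : ∀ w, π (ι w) = w)
    (hι : ∀ g w, ι (π (ρ g (ι w))) = ρ g (ι w))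
    (hv : ∃ w, w ≠ 0 ∧ derivOne ρ X (ι w) = c • ι w) :
    ∃ σ : G →* (W →L[ℂ] W), IsAdmissible g₀ X c σ := by
  have hmul : ∀ g g' w, π (ρ g (ι (π (ρ g' (ι w))))) = π (ρ g (ρ g' (ι w))) := by
    intro g g' w; rw [hι]
  have hσ := mdiffOne_compressionHom hρ.mdiffOne h hmul
  refine ⟨compressionHom ρ π ι h hmul, hσ, ?_, ?_⟩
  · ext w
    simp [compressionHom, hρ.map_eq_one, h]
  · obtain ⟨w, hw, hwc⟩ := hv
    refine ⟨w, hw, ?_⟩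
    have h1 := derivOne_intertwine hσ hρ.mdiffOne (T := ι)
      (fun g => by ext w; simp [compressionHom, hι]) X
    have h2 := congrArg (fun f => π (f w)) h1
    simpa [h, hwc] using h2

theorem IsAdmissible.quotient {g₀ : G} {X : E} {c : ℂ} {ρ : G →* (V →L[ℂ] V)}
    (hρ : IsAdmissible g₀ X c ρ) {π : V →L[ℂ] W} {ι : W →L[ℂ] V} (h : ∀ w, π (ι w) = w)
    (hπ : ∀ g v, π (ρ g (ι (π v))) = π (ρ g v))
    (hv : ∃ v, π v ≠ 0 ∧ derivOne ρ X v = c • v) :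
    ∃ σ : G →* (W →L[ℂ] W), IsAdmissible g₀ X c σ := by
  have hmul : ∀ g g' w, π (ρ g (ι (π (ρ g' (ι w))))) = π (ρ g (ρ g' (ι w))) := by
    intro g g' w; rw [hπ]
  have hσ := mdiffOne_compressionHom hρ.mdiffOne h hmul
  refine ⟨compressionHom ρ π ι h hmul, hσ, ?_, ?_⟩
  · ext w
    simp [compressionHom, hρ.map_eq_one, h]
  · obtain ⟨v, hv, hvc⟩ := hv
    refine ⟨π v, hv, ?_⟩
    have h1 := derivOne_intertwine hρ.mdiffOne hσ (T := π)
      (fun g => by ext w; simp [compressionHom, hπ]) X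
    have h2 := congrArg (fun f => f v) h1
    simpa [hvc] using h2.symm

/-- `ρ` has no invariant subspaces other than `⊥` and `⊤`. -/
def NoInvariantSubspace (ρ : G →* (V →L[ℂ] V)) : Prop :=
  ∀ S : Submodule ℂ V, (∀ g, ∀ v ∈ S, ρ g v ∈ S) → S = ⊥ ∨ S = ⊤

theorem IsAdmissible.exists_euclidean [FiniteDimensional ℂ V] {g₀ : G} {X : E} {c : ℂ}
    {ρ : G →* (V →L[ℂ] V)}
    (hρ : IsAdmissible g₀ X c ρ) :
    ∃ σ : G →* (EuclideanSpace ℂ (Fin (Module.finrank ℂ V)) →L[ℂ]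
      EuclideanSpace ℂ (Fin (Module.finrank ℂ V))), IsAdmissible g₀ X c σ := by
  let e : V ≃L[ℂ] EuclideanSpace ℂ (Fin (Module.finrank ℂ V)) :=
    (LinearEquiv.ofFinrankEq _ _ (by simp)).toContinuousLinearEquiv
  obtain ⟨v, hv, hvc⟩ := hρ.exists_eigenvector
  exact hρ.sub (π := (e : V →L[ℂ] _)) (ι := (e.symm : _ →L[ℂ] V)) (by simp) (by simp)
    ⟨e v, by simpa using hv, by simpa using hvc⟩

/-- An eigenvector either lies in an invariant subspace or has nonzero image in the quotient, so
descending to the appropriate one keeps `c`. Complete reducibility is not needed. -/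
theorem IsAdmissible.exists_irreducible {g₀ : G} {X : E} {c : ℂ} (d : ℕ) :
    ∀ ρ : G →* (EuclideanSpace ℂ (Fin d) →L[ℂ] EuclideanSpace ℂ (Fin d)), IsAdmissible g₀ X c ρ →
    ∃ (d' : ℕ) (σ : G →* (EuclideanSpace ℂ (Fin d') →L[ℂ] EuclideanSpace ℂ (Fin d'))),
      IsAdmissible g₀ X c σ ∧ NoInvariantSubspace σ := by
  induction d using Nat.strong_induction_on with
  | _ d ih =>
  intro ρ hρ
  by_cases hirr : NoInvariantSubspace ρ
  · exact ⟨d, ρ, hρ, hirr⟩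
  unfold NoInvariantSubspace at hirr
  push Not at hirr
  obtain ⟨S, hS, hbot, htop⟩ := hirr
  obtain ⟨v, hv, hvc⟩ := hρ.exists_eigenvector
  by_cases hvS : v ∈ S
  · have hlt : Module.finrank ℂ S < d := by
      simpa using Submodule.finrank_lt htop
    let e : EuclideanSpace ℂ (Fin (Module.finrank ℂ S)) ≃ₗ[ℂ] S :=
      LinearEquiv.ofFinrankEq _ _ (by simp)
    obtain ⟨π, hπ⟩ := LinearMap.exists_leftInverse_of_injective (S.subtype ∘ₗ e.toLinearMap)
      (LinearMap.ker_eq_bot.2 (S.injective_subtype.comp e.injective))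
    have hπ' (w) : π (e w) = w := congrArg (fun f => f w) hπ
    obtain ⟨σ, hσ⟩ := hρ.sub (π := LinearMap.toContinuousLinearMap π)
      (ι := LinearMap.toContinuousLinearMap (S.subtype ∘ₗ e.toLinearMap)) (by simpa using hπ')
      (fun g w => by
        have h1 := hS g (e w) (e w).2
        have h2 := hπ' (e.symm ⟨_, h1⟩)
        rw [e.apply_symm_apply] at h2
        simp [h2])
      ⟨e.symm ⟨v, hvS⟩, by simpa using hv, by simpa using hvc⟩
    exact ih _ hlt σ hσ
  · have hlt : Module.finrank ℂ (EuclideanSpace ℂ (Fin d) ⧸ S) < d := by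
      have h1 := S.finrank_quotient_add_finrank
      have h2 : Module.finrank ℂ S ≠ 0 := fun h => hbot (Submodule.finrank_eq_zero.1 h)
      simp at h1
      omega
    let e : (EuclideanSpace ℂ (Fin d) ⧸ S) ≃ₗ[ℂ]
        EuclideanSpace ℂ (Fin (Module.finrank ℂ (EuclideanSpace ℂ (Fin d) ⧸ S))) :=
      LinearEquiv.ofFinrankEq _ _ (by simp)
    obtain ⟨ι, hι⟩ := LinearMap.exists_rightInverse_of_surjective (e.toLinearMap ∘ₗ S.mkQ)
      (LinearMap.range_eq_top.2 (e.surjective.comp S.mkQ_surjective))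
    have hι' (w) : e (S.mkQ (ι w)) = w := congrArg (fun f => f w) hι
    have hsub (w) : ι (e (S.mkQ w)) - w ∈ S := by
      exact (Submodule.Quotient.eq S).1 (e.injective (hι' (e (S.mkQ w))))
    obtain ⟨σ, hσ⟩ := hρ.quotient
      (π := LinearMap.toContinuousLinearMap (e.toLinearMap ∘ₗ S.mkQ))
      (ι := LinearMap.toContinuousLinearMap ι) (by simpa using hι')
      (fun g w => by
        have h1 := hS g _ (hsub w)
        rw [map_sub] at h1
        exact congrArg e ((Submodule.Quotient.eq S).2 h1))
      ⟨v, by simpa using hvS, hvc⟩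
    exact ih _ hlt σ hσ

/-- Product rule for the two commuting factors of a tensor square. Triviality at `g₀` holds because
`σ` depends on the group element only through `ρ`. -/
theorem IsAdmissible.of_mul {g₀ : G} {X : E} {c c' : ℂ} {ρ : G →* (V →L[ℂ] V)}
    (hρ : IsAdmissible g₀ X c ρ) (α β : (V →L[ℂ] V) →L[ℂ] (W →L[ℂ] W)) (σ : G →* (W →L[ℂ] W))
    (hσ : ∀ g, σ g = α (ρ g) * β (ρ g)) {w : W} (hw : w ≠ 0)
    (hwc : (α 1 * β (derivOne ρ X) + α (derivOne ρ X) * β 1) w = c' • w) :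
    IsAdmissible g₀ X c' σ := by
  have hα : MDiffOne E (fun g => α (ρ g)) := hρ.mdiffOne.clm (α.restrictScalars ℝ)
  have hβ : MDiffOne E (fun g => β (ρ g)) := hρ.mdiffOne.clm (β.restrictScalars ℝ)
  have dα : derivOne (fun g => α (ρ g)) X = α (derivOne ρ X) :=
    hρ.mdiffOne.derivOne_clm (α.restrictScalars ℝ) X
  have dβ : derivOne (fun g => β (ρ g)) X = β (derivOne ρ X) :=
    hρ.mdiffOne.derivOne_clm (β.restrictScalars ℝ) X
  have hfun : ⇑σ = fun g => α (ρ g) * β (ρ g) := funext hσ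
  refine ⟨?_, ?_, w, hw, ?_⟩
  · rw [hfun]; exact hα.mul hβ
  · rw [hσ, hρ.map_eq_one, ← map_one ρ, ← hσ, map_one]
  · rw [hfun, hα.derivOne_mul hβ, dα, dβ, map_one, hwc]

/-- The representation on the operators from the dual of `V` to `V`, that is, on `V ⊗ V`. -/
noncomputable def squareHom (ρ : G →* (V →L[ℂ] V)) :
    G →* (((V →L[ℂ] ℂ) →L[ℂ] V) →L[ℂ] ((V →L[ℂ] ℂ) →L[ℂ] V)) where
  toFun g := ContinuousLinearMap.compL ℂ (V →L[ℂ] ℂ) V V (ρ g) *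
    (ContinuousLinearMap.compL ℂ (V →L[ℂ] ℂ) (V →L[ℂ] ℂ) V).flip
      ((ContinuousLinearMap.compL ℂ V V ℂ).flip (ρ g))
  map_one' := by ext T ξ; simp [ContinuousLinearMap.one_def]
  map_mul' g h := by ext T ξ; simp [ContinuousLinearMap.mul_def, ContinuousLinearMap.comp_assoc]

theorem IsAdmissible.squareHom {g₀ : G} {X : E} {c : ℂ} {ρ : G →* (V →L[ℂ] V)}
    (hρ : IsAdmissible g₀ X c ρ) :
    IsAdmissible (V := (V →L[ℂ] ℂ) →L[ℂ] V) g₀ X (2 * c) (squareHom ρ) := by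
  obtain ⟨v, hv, hvc⟩ := hρ.exists_eigenvector
  -- The eigenvector is `v ⊗ v`, written as the rank-one operator `ξ ↦ ξ v • v`.
  refine hρ.of_mul (ContinuousLinearMap.compL ℂ (V →L[ℂ] ℂ) V V)
    ((ContinuousLinearMap.compL ℂ (V →L[ℂ] ℂ) (V →L[ℂ] ℂ) V).flip ∘L
      (ContinuousLinearMap.compL ℂ V V ℂ).flip) _ (fun g => rfl)
    (w := (ContinuousLinearMap.apply ℂ ℂ v).smulRight v) ?_ ?_
  · obtain ⟨ξ, hξ⟩ := SeparatingDual.exists_ne_zero (R := ℂ) hv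
    intro h
    have := congrArg (fun f => f ξ) h
    simp [hξ, hv] at this
  · ext ξ
    simp [hvc, ContinuousLinearMap.one_def, ContinuousLinearMap.mul_def]
    module

end Representations

/-! ### Large eigenvalues force large dimension. -/

section Bound

/-- Lets a polynomial annihilating `ad X` annihilate the commutator action in every representation,
so that one `R` serves them all. -/
theorem aeval_commutatorMap_apply {E U : Type*} [AddCommGroup E] [Module ℝ E]
    [AddCommGroup U] [Module ℂ U] {A : Module.End ℂ U} {a : Module.End ℝ E}
    {L : E →+ Module.End ℂ U} (hsmul : ∀ (r : ℝ) Y, L (r • Y) = (r : ℂ) • L Y)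
    (hL : ∀ Y, commutatorMap A (L Y) = L (a Y)) (p : Polynomial ℝ) (Y : E) :
    Polynomial.aeval (commutatorMap A) (p.map (algebraMap ℝ ℂ)) (L Y) =
      L (Polynomial.aeval a p Y) := by
  induction p using Polynomial.induction_on' with
  | add p q hp hq =>
    rw [Polynomial.map_add, map_add, LinearMap.add_apply, hp, hq, map_add, LinearMap.add_apply,
      map_add]
  | monomial n r =>
    have hpow : ∀ n : ℕ, ((commutatorMap A) ^ n) (L Y) = L ((a ^ n) Y) := by
      intro n
      induction n with
      | zero => simp
      | succ n ih => rw [pow_succ', Module.End.mul_apply, ih, hL, pow_succ', Module.End.mul_apply]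
    rw [Polynomial.map_monomial, Polynomial.aeval_monomial, Polynomial.aeval_monomial]
    simp only [Algebra.algebraMap_eq_smul_one, smul_mul_assoc, one_mul, LinearMap.smul_apply, hpow,
      hsmul]
    simp

variable {E : Type*} [NormedAddCommGroup E] [NormedSpace ℝ E]
  {G : Type*} [TopologicalSpace G] [ChartedSpace E G] [Group G]
  {V : Type*} [NormedAddCommGroup V] [NormedSpace ℂ V] [FiniteDimensional ℂ V]

theorem exists_admissible_pow_two {g₀ : G} {X : E} {c : ℂ} {ρ : G →* (V →L[ℂ] V)}
    (hρ : IsAdmissible g₀ X c ρ) (m : ℕ) :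
    ∃ (d : ℕ) (σ : G →* (EuclideanSpace ℂ (Fin d) →L[ℂ] EuclideanSpace ℂ (Fin d))),
      IsAdmissible g₀ X (2 ^ m * c) σ ∧ NoInvariantSubspace σ := by
  induction m with
  | zero =>
    obtain ⟨σ, hσ⟩ := hρ.exists_euclidean
    rw [pow_zero, one_mul]
    exact IsAdmissible.exists_irreducible _ σ hσ
  | succ m ih =>
    obtain ⟨d, σ, hσ, -⟩ := ih
    obtain ⟨τ, hτ⟩ := hσ.squareHom.exists_euclidean
    rw [pow_succ', mul_assoc]
    exact IsAdmissible.exists_irreducible _ τ hτ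

variable [LieGroup 𝓘(ℝ, E) ∞ G]

theorem norm_eigenvalue_le_of_noInvariantSubspace [FiniteDimensional ℝ E] [PreconnectedSpace G]
    {p : Polynomial ℝ} {x y : E}
    (hp : Polynomial.aeval (derivOne (adHom E G) (groupBracket G x y) : E →ₗ[ℝ] E) p = 0)
    {R : ℝ} (hR : 0 < R) (hpR : ∀ μ, (p.map (algebraMap ℝ ℂ)).IsRoot μ → ‖μ‖ ≤ R)
    {g₀ : G} {c : ℂ} {ρ : G →* (V →L[ℂ] V)} (hρ : IsAdmissible g₀ (groupBracket G x y) c ρ)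
    (hirr : NoInvariantSubspace ρ) : ‖c‖ ≤ Module.finrank ℂ V * R := by
  have hmd := hρ.mdiffOne
  obtain ⟨v, hv, hvc⟩ := hρ.exists_eigenvector
  set X := groupBracket G x y with hX
  let L : E →+ Module.End ℂ V :=
    { toFun := fun Y => (derivOne ρ Y : V →ₗ[ℂ] V)
      map_zero' := by ext; simp
      map_add' := by intro Y Z; ext; simp }
  have hsmul : ∀ (r : ℝ) Y, L (r • Y) = (r : ℂ) • L Y := by
    intro r Y
    ext w
    simp [L]
  have hL : ∀ Y, commutatorMap (L X) (L Y) = L (derivOne (adHom E G) X Y) := by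
    intro Y
    rw [derivOne_adHom]
    ext w
    simp [L, derivOne_groupBracket ρ hmd, commutatorMap]
  refine norm_eigenvalue_le (A := L X) (𝒯 := Set.range L) hR hpR ?_ ?_ ?_
    (Module.End.hasEigenvalue_of_hasEigenvector (x := v)
      ⟨Module.End.mem_eigenspace_iff.2 hvc, hv⟩)
  · rintro _ ⟨Y, rfl⟩
    rw [aeval_commutatorMap_apply (a := (derivOne (adHom E G) X : E →ₗ[ℝ] E)) hsmul hL, hp]
    simp
  · intro S S' hSS hS hS'
    -- The projection along an invariant complement commutes with the Lie algebra, hence with the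
    -- group, which makes `S` invariant under the group.
    set P := LinearMap.toContinuousLinearMap (S.projection S' hSS) with hPdef
    have hPmem (w) : P w ∈ S := Submodule.projection_apply_mem hSS w
    have hPS {w} (hw : w ∈ S) : P w = w :=
      Submodule.projection_apply_left hSS ⟨w, hw⟩
    have hPS' {w} (hw : w ∈ S') : P w = 0 :=
      (Submodule.projection_apply_eq_zero_iff hSS).2 hw
    have hcomm : ∀ Y : E, derivOne ρ Y * P = P * derivOne ρ Y := by
      intro Y
      ext w
      obtain ⟨s, hs, s', hs', rfl⟩ := Submodule.mem_sup.1
        (hSS.sup_eq_top ▸ Submodule.mem_top : w ∈ S ⊔ S')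
      have h1 : derivOne ρ Y s ∈ S := hS (L Y) ⟨Y, rfl⟩ s hs
      have h2 : derivOne ρ Y s' ∈ S' := hS' (L Y) ⟨Y, rfl⟩ s' hs'
      simp [hPS hs, hPS' hs', hPS h1, hPS' h2]
    refine hirr S fun g w hw => ?_
    have h1 := congrArg (fun f => f w) (commute_of_commute_derivOne ρ hmd hcomm g)
    simp only [mul_apply_eq_comp, hPS hw] at h1
    rw [h1]
    exact hPmem _
  · have : L X = L x * L y - L y * L x := by
      ext w
      simp [L, hX, derivOne_groupBracket ρ hmd]
    rw [this, map_sub, LinearMap.trace_mul_comm, sub_self]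

theorem exists_admissible_finrank_gt [FiniteDimensional ℝ E] [PreconnectedSpace G]
    {g₀ : G} {x y : E} {c : ℂ} (hc : c ≠ 0) {ρ : G →* (V →L[ℂ] V)}
    (hρ : IsAdmissible g₀ (groupBracket G x y) c ρ) (N : ℕ) :
    ∃ (d : ℕ) (σ : G →* (EuclideanSpace ℂ (Fin d) →L[ℂ] EuclideanSpace ℂ (Fin d))),
      N < d ∧ MDiffOne E σ ∧ σ g₀ = 1 ∧ NoInvariantSubspace σ := by
  set a := (derivOne (adHom E G) (groupBracket G x y) : E →ₗ[ℝ] E) with ha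
  set p := a.charpoly with hp
  have hp0 : p.map (algebraMap ℝ ℂ) ≠ 0 :=
    ((LinearMap.charpoly_monic a).map _).ne_zero
  obtain ⟨R, hR, hpR⟩ :=
    (Polynomial.finite_setOfPred_isRoot hp0).isBounded.exists_pos_norm_le
  -- Chosen so that `N * R < 2 ^ m * ‖c‖`, while the eigenvalue bound gives `2 ^ m * ‖c‖ ≤ d * R`.
  obtain ⟨m, hm⟩ := pow_unbounded_of_one_lt (N * R / ‖c‖) (one_lt_two (α := ℝ))
  obtain ⟨d, σ, hσ, hirr⟩ := exists_admissible_pow_two hρ m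
  refine ⟨d, σ, ?_, hσ.mdiffOne, hσ.map_eq_one, hirr⟩
  have h1 := norm_eigenvalue_le_of_noInvariantSubspace (p := p) (LinearMap.aeval_self_charpoly a)
    hR hpR hσ hirr
  have hc' : 0 < ‖c‖ := norm_pos_iff.2 hc
  rw [div_lt_iff₀ hc'] at hm
  simp only [norm_mul, norm_pow, Complex.norm_ofNat, finrank_euclideanSpace, Fintype.card_fin] at h1
  have h2 := lt_of_lt_of_le hm h1
  exact_mod_cast lt_of_mul_lt_mul_right h2 hR.le

end Bound

/-! ### Invariant inner products by Haar averaging. -/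

section Averaging

open MeasureTheory in
/-- A representation of a compact group on a finite-dimensional real space has an invariant
inner product. -/
theorem exists_invariant_bilinForm {G : Type*} [TopologicalSpace G] [Group G] [IsTopologicalGroup G]
    [CompactSpace G] {E : Type*} [NormedAddCommGroup E] [NormedSpace ℝ E] [FiniteDimensional ℝ E]
    (ρ : G →* (E →L[ℝ] E)) (hρ : Continuous ρ) :
    ∃ B : LinearMap.BilinForm ℝ E, (∀ x y, B x y = B y x) ∧ (∀ x, x ≠ 0 → 0 < B x x) ∧
      ∀ g x y, B (ρ g x) (ρ g y) = B x y := by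
  borelize G
  let e : E ≃L[ℝ] EuclideanSpace ℝ (Fin (Module.finrank ℝ E)) :=
    (LinearEquiv.ofFinrankEq _ _ (by simp)).toContinuousLinearEquiv
  -- With `g⁻¹` in the integrand, left invariance of Haar measure yields invariance of the form.
  let F : E → E → G → ℝ := fun x y g => inner ℝ (e (ρ g⁻¹ x)) (e (ρ g⁻¹ y))
  have hcont (x : E) : Continuous fun g : G => e (ρ g⁻¹ x) :=
    e.continuous.comp ((hρ.comp continuous_inv).clm_apply continuous_const)
  have hF (x y : E) : Continuous (F x y) := (hcont x).inner (hcont y)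
  let μ : Measure G := Measure.haar
  have hint (x y : E) : Integrable (F x y) μ :=
    (hF x y).integrable_of_hasCompactSupport (HasCompactSupport.of_compactSpace _)
  refine ⟨LinearMap.mk₂ ℝ (fun x y => ∫ g, F x y g ∂μ) ?_ ?_ ?_ ?_, ?_, ?_, ?_⟩
  · intro x x' y
    rw [← integral_add (hint x y) (hint x' y)]
    simp [F, inner_add_left]
  · intro c x y
    rw [smul_eq_mul, ← integral_const_mul]
    simp [F, inner_smul_left]
  · intro x y y'
    rw [← integral_add (hint x y) (hint x y')]
    simp [F, inner_add_right]
  · intro c x y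
    rw [smul_eq_mul, ← integral_const_mul]
    simp [F, inner_smul_right]
  · intro x y
    simp [F, real_inner_comm]
  · intro x hx
    simp only [LinearMap.mk₂_apply]
    refine (hF x x).integral_pos_of_hasCompactSupport_nonneg_nonzero (x := 1)
      (HasCompactSupport.of_compactSpace _) (fun g => real_inner_self_nonneg) ?_
    simpa [F] using hx
  · intro g x y
    simp only [LinearMap.mk₂_apply]
    rw [← integral_mul_left_eq_self (F x y) g⁻¹]
    simp [F]

end Averaging

/-! ### Skew operators, nonzero eigenvalues and complexification. -/

section Linear

/-- For skew `A`, `B (A u) (A u) = -B u (A (A u))`, so `A (A u) = 0` already forces `A u = 0`. -/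
theorem apply_eq_zero_of_pow_apply_eq_zero {E : Type*} [AddCommGroup E] [Module ℝ E]
    {B : LinearMap.BilinForm ℝ E} (hpos : ∀ x, x ≠ 0 → 0 < B x x) {A : Module.End ℝ E}
    (hA : ∀ x y, B (A x) y = - B x (A y)) (n : ℕ) {x : E} (hx : (A ^ (n + 1)) x = 0) :
    A x = 0 := by
  induction n with
  | zero => simpa using hx
  | succ n ih =>
    refine ih ?_
    by_contra hne
    have h1 := hpos _ hne
    have h2 : A ((A ^ (n + 1)) x) = 0 := by
      rw [← Module.End.mul_apply, ← pow_succ']; exact hx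
    have h3 : (A ^ (n + 1)) x = A ((A ^ n) x) := by rw [pow_succ', Module.End.mul_apply]
    rw [h3] at h1 h2
    rw [hA, h2] at h1
    simp at h1

theorem exists_hasEigenvalue_ne_zero {U : Type*} [AddCommGroup U] [Module ℂ U]
    [FiniteDimensional ℂ U] {f : Module.End ℂ U} (hf : ¬ IsNilpotent f) :
    ∃ c, c ≠ 0 ∧ f.HasEigenvalue c := by
  by_contra! hcon
  refine hf ⟨Module.finrank ℂ U, ?_⟩
  have htop : f.maxGenEigenspace 0 = ⊤ := by
    rw [← top_le_iff, ← Module.End.iSup_maxGenEigenspace_eq_top f]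
    refine iSup_le fun c => ?_
    by_cases hc : c = 0
    · rw [hc]
    · by_cases hb : f.maxGenEigenspace c = ⊥
      · rw [hb]; exact bot_le
      · exact absurd (hasEigenvalue_of_maxGenEigenspace_ne_bot hb) (hcon c hc)
  rw [Module.End.maxGenEigenspace_eq_genEigenspace_finrank, Module.End.genEigenspace_nat,
    zero_smul, sub_zero] at htop
  exact LinearMap.ker_eq_top.1 htop

/-- Complexification of operators, as a ring homomorphism into operators on a Euclidean space. -/
noncomputable def complexifyHom (J : Type*) [NormedAddCommGroup J] [NormedSpace ℝ J]
    [FiniteDimensional ℝ J] :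
    (J →L[ℝ] J) →+* (EuclideanSpace ℂ (Fin (Module.finrank ℝ J)) →L[ℂ]
      EuclideanSpace ℂ (Fin (Module.finrank ℝ J))) :=
  ((Matrix.toEuclideanCLM (n := Fin (Module.finrank ℝ J)) (𝕜 := ℂ) :
      Matrix _ _ ℂ →+* _).comp (RingHom.mapMatrix Complex.ofRealHom)).comp
    ((LinearMap.toMatrixAlgEquiv (Module.finBasis ℝ J)).toRingEquiv.toRingHom.comp
      ContinuousLinearMap.toLinearMapRingHom)

theorem complexifyHom_injective (J : Type*) [NormedAddCommGroup J] [NormedSpace ℝ J]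
    [FiniteDimensional ℝ J] : Function.Injective (complexifyHom J) := by
  intro S T h
  have h1 := Matrix.map_injective Complex.ofReal_injective
    ((Matrix.toEuclideanCLM (n := Fin (Module.finrank ℝ J)) (𝕜 := ℂ)).injective h)
  exact ContinuousLinearMap.coe_injective
    ((LinearMap.toMatrixAlgEquiv (Module.finBasis ℝ J)).injective h1)

theorem complexifyHom_smul (J : Type*) [NormedAddCommGroup J] [NormedSpace ℝ J]
    [FiniteDimensional ℝ J] (r : ℝ) (T : J →L[ℝ] J) :
    complexifyHom J (r • T) = r • complexifyHom J T := by
  have h (M : Matrix (Fin (Module.finrank ℝ J)) (Fin (Module.finrank ℝ J)) ℝ) :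
      (r • M).map Complex.ofRealHom = (r : ℂ) • M.map Complex.ofRealHom := by
    ext i j
    simp
  have h2 := h (LinearMap.toMatrixAlgEquiv (Module.finBasis ℝ J) (T : J →ₗ[ℝ] J))
  rw [← map_smul] at h2
  exact (congrArg (Matrix.toEuclideanCLM (n := Fin (Module.finrank ℝ J)) (𝕜 := ℂ)) h2).trans
    (map_smul _ _ _)

/-- Complexification of operators as a continuous linear map. -/
noncomputable def complexifyCLM (J : Type*) [NormedAddCommGroup J] [NormedSpace ℝ J]
    [FiniteDimensional ℝ J] :
    (J →L[ℝ] J) →L[ℝ] (EuclideanSpace ℂ (Fin (Module.finrank ℝ J)) →L[ℂ]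
      EuclideanSpace ℂ (Fin (Module.finrank ℝ J))) :=
  LinearMap.toContinuousLinearMap
    { toFun := complexifyHom J
      map_add' := map_add _
      map_smul' := complexifyHom_smul J }

end Linear

/-! ### Splitting the Lie algebra and constructing the representations. -/

section Core

variable {E : Type*} [NormedAddCommGroup E] [NormedSpace ℝ E] [FiniteDimensional ℝ E]
  {G : Type*} [TopologicalSpace G] [ChartedSpace E G] [Group G] [LieGroup 𝓘(ℝ, E) ∞ G]

theorem groupBracket_skew (X Y : E) : groupBracket G X Y = - groupBracket G Y X :=
  (lie_skew (show GroupLieAlgebra 𝓘(ℝ, E) G from X) (show GroupLieAlgebra 𝓘(ℝ, E) G from Y)).symm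

/-- Differentiate `B (Ad g x) y = B x (Ad g⁻¹ y)` at the identity. -/
theorem exists_invariant_skew_bilinForm [CompactSpace G] :
    ∃ B : LinearMap.BilinForm ℝ E, (∀ x y, B x y = B y x) ∧ (∀ x, x ≠ 0 → 0 < B x x) ∧
      ∀ X x y, B (groupBracket G X x) y = - B x (groupBracket G X y) := by
  have := topologicalGroup_of_lieGroup 𝓘(ℝ, E) ∞ (G := G)
  obtain ⟨B, hB1, hB2, hB3⟩ := exists_invariant_bilinForm (adHom E G)
    (continuous_of_mdiffOne _ mdiffOne_adHom)
  refine ⟨B, hB1, hB2, fun X x y => ?_⟩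
  have h (g : G) : B (adHom E G g x) y = B x (adHom E G g⁻¹ y) := by
    rw [← hB3 g x, ← mul_apply_eq_comp, ← map_mul]
    simp
  let L1 : (E →L[ℝ] E) →L[ℝ] ℝ :=
    LinearMap.toContinuousLinearMap (B.flip y) ∘L ContinuousLinearMap.apply ℝ E x
  let L2 : (E →L[ℝ] E) →L[ℝ] ℝ :=
    LinearMap.toContinuousLinearMap (B x) ∘L ContinuousLinearMap.apply ℝ E y
  have h1 := (mdiffOne_adHom (E := E) (G := G)).derivOne_clm L1 X
  have h2 := (mdiffOne_inv (E := E) (adHom E G) mdiffOne_adHom).derivOne_clm L2 X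
  have h3 : (fun g : G => L1 (adHom E G g)) = fun g => L2 (adHom E G g⁻¹) := funext h
  rw [h3, h2, derivOne_inv _ mdiffOne_adHom] at h1
  have h4 : B x (-(derivOne (adHom E G) X) y) = B (derivOne (adHom E G) X x) y := h1
  rw [derivOne_adHom, derivOne_adHom] at h4
  rw [← h4, map_neg]

variable [PreconnectedSpace G]

theorem exists_representations_of_isCompl {B : LinearMap.BilinForm ℝ E}
    (hpos : ∀ x, x ≠ 0 → 0 < B x x)
    (hskew : ∀ X x y, B (groupBracket G X x) y = - B x (groupBracket G X y))
    {I J : Submodule ℝ E} (hIJ : IsCompl J I) (hI : ∀ X, ∀ v ∈ I, groupBracket G X v ∈ I)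
    (hJ : ∀ X, ∀ v ∈ J, groupBracket G X v ∈ J) (hIbot : I ≠ ⊥)
    (hne : ∃ x ∈ J, ∃ y ∈ J, groupBracket G x y ≠ 0) :
    ∃ g₀ : G, g₀ ≠ 1 ∧ ∀ N : ℕ, ∃ (d : ℕ)
      (σ : G →* (EuclideanSpace ℂ (Fin d) →L[ℂ] EuclideanSpace ℂ (Fin d))),
      N < d ∧ Continuous σ ∧ σ g₀ = 1 ∧ NoInvariantSubspace σ := by
  obtain ⟨x, hx, y, hy, hxy⟩ := hne
  set X := groupBracket G x y with hX
  let π : E →L[ℝ] J := LinearMap.toContinuousLinearMap (J.projectionOnto I hIJ)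
  let ι : J →L[ℝ] E := J.subtypeL
  have hπι (w : J) : π (ι w) = w := Submodule.projectionOnto_apply_left hIJ w
  have hιπ {v : E} (hv : v ∈ J) : ι (π v) = v := congrArg Subtype.val (hπι ⟨v, hv⟩)
  have hπI {v : E} (hv : v ∈ I) : π v = 0 := (Submodule.projectionOnto_apply_eq_zero_iff hIJ).2 hv
  have hbr (Y : E) (v : E) : derivOne (adHom E G) Y v = groupBracket G Y v := derivOne_adHom Y v
  -- The projection onto `J` along `I` commutes with `ad`, hence with `Ad`; so the adjoint action
  -- restricts to `J`.
  have hcomm : ∀ Y : E, derivOne (adHom E G) Y * (ι ∘L π) = (ι ∘L π) * derivOne (adHom E G) Y := by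
    intro Y
    ext w
    obtain ⟨s, hs, s', hs', rfl⟩ := Submodule.mem_sup.1
      (hIJ.sup_eq_top ▸ Submodule.mem_top : w ∈ J ⊔ I)
    simp only [mul_apply_eq_comp, ContinuousLinearMap.comp_apply, map_add, hbr]
    simp [hιπ hs, hπI hs', hιπ (hJ Y s hs), hπI (hI Y s' hs')]
    rw [← hbr, map_zero]
  have hAd (g : G) (w : J) : ι (π (adHom E G g (ι w))) = adHom E G g (ι w) := by
    have := congrArg (fun f => f (ι w)) (commute_of_commute_derivOne _ mdiffOne_adHom hcomm g)
    simpa [hπι] using this.symm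
  let τ : G →* (J →L[ℝ] J) := compressionHom (adHom E G) π ι hπι fun g g' w => by rw [hAd]
  let C : (E →L[ℝ] E) →L[ℝ] (J →L[ℝ] J) :=
    ContinuousLinearMap.compL ℝ J E J π ∘L (ContinuousLinearMap.compL ℝ J E E).flip ι
  have hτ0 : MDiffOne E (fun g : G => C (adHom E G g)) :=
    MDiffOne.clm (W := E →L[ℝ] E) (W' := J →L[ℝ] J) (f := adHom E G) mdiffOne_adHom C
  have hτ : MDiffOne E τ := hτ0
  have dτ (Y : E) (w : J) : derivOne τ Y w = π (groupBracket G Y w) := by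
    have : derivOne τ Y = C (derivOne (adHom E G) Y) :=
      MDiffOne.derivOne_clm (W := E →L[ℝ] E) (W' := J →L[ℝ] J) (f := adHom E G) mdiffOne_adHom C Y
    rw [this, ← derivOne_adHom]
    rfl
  let σ := (complexifyHom J).toMonoidHom.comp τ
  have hσ : MDiffOne E σ := hτ.clm (complexifyCLM J)
  have dσ (Y : E) : derivOne σ Y = complexifyHom J (derivOne τ Y) :=
    hτ.derivOne_clm (complexifyCLM J) Y
  obtain ⟨i, hi, hi0⟩ := Submodule.exists_mem_ne_zero_of_ne_bot hIbot
  have hdi : derivOne σ i = 0 := by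
    have : derivOne τ i = 0 := by
      ext w
      rw [dτ, hπI]
      · rfl
      · rw [groupBracket_skew]
        exact I.neg_mem (hI _ _ hi)
    rw [dσ, this, map_zero]
  have : CompleteSpace E := FiniteDimensional.complete ℝ E
  obtain ⟨g₀, hg₀, hσg₀⟩ := exists_ne_one_map_eq_one σ hσ hi0 hdi
  -- Nilpotency on `J` and skewness would give `[X, x] = 0`, and then `B X X = -B y [x, X] = 0`,
  -- although `X ≠ 0`.
  have hnil : ¬ IsNilpotent (derivOne σ X).toLinearMap := by
    rintro ⟨n, hn⟩
    have h1 : (derivOne σ X) ^ n = 0 := by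
      ext v
      have := congrArg (fun f => f v) hn
      rw [← ContinuousLinearMap.toLinearMap_pow] at this
      exact congrFun (congrArg _ this) _
    have h2 : (derivOne τ X) ^ n = 0 := by
      apply complexifyHom_injective J
      rw [map_pow, ← dσ, h1, map_zero]
    have h3 (m : ℕ) (w : J) : ι (((derivOne τ X) ^ m) w) =
        ((derivOne (adHom E G) X : Module.End ℝ E) ^ m) (ι w) := by
      induction m with
      | zero => simp
      | succ m ih =>
        rw [pow_succ', pow_succ', Module.End.mul_apply, ← ih, mul_apply_eq_comp, dτ,
          hιπ (hJ _ _ (Subtype.mem _))]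
        exact (hbr _ _).symm
    have h4 : groupBracket G X x = 0 := by
      rw [← hbr]
      refine apply_eq_zero_of_pow_apply_eq_zero (A := (derivOne (adHom E G) X : E →ₗ[ℝ] E))
        hpos (fun u v => ?_) n ?_
      · simpa [hbr] using hskew X u v
      · have := h3 (n + 1) ⟨x, hx⟩
        rw [pow_succ, h2, zero_mul] at this
        exact this.symm
    have h5 := hpos X hxy
    rw [hX, hskew, ← hX, groupBracket_skew, h4] at h5
    simp at h5
  obtain ⟨c, hc, hcv⟩ := exists_hasEigenvalue_ne_zero hnil
  obtain ⟨v, hv⟩ := hcv.exists_hasEigenvector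
  refine ⟨g₀, hg₀, fun N => ?_⟩
  have hadm : IsAdmissible g₀ (groupBracket G x y) c σ :=
    ⟨hσ, hσg₀, v, hv.2, Module.End.mem_eigenspace_iff.1 hv.1⟩
  obtain ⟨d, ρ, h1, h2, h3, h4⟩ := exists_admissible_finrank_gt hc hadm N
  exact ⟨d, ρ, h1, continuous_of_mdiffOne ρ h2, h3, h4⟩

theorem exists_representations [CompactSpace G]
    (hnonabelian : ¬ IsLieAbelian (GroupLieAlgebra 𝓘(ℝ, E) G))
    (hnonsimple : ¬ LieAlgebra.IsSimple ℝ (GroupLieAlgebra 𝓘(ℝ, E) G)) :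
    ∃ g₀ : G, g₀ ≠ 1 ∧ ∀ N : ℕ, ∃ (d : ℕ)
      (σ : G →* (EuclideanSpace ℂ (Fin d) →L[ℂ] EuclideanSpace ℂ (Fin d))),
      N < d ∧ Continuous σ ∧ σ g₀ = 1 ∧ NoInvariantSubspace σ := by
  have hideal : ∃ I : LieIdeal ℝ (GroupLieAlgebra 𝓘(ℝ, E) G), I ≠ ⊥ ∧ I ≠ ⊤ := by
    by_contra! hcon
    exact hnonsimple ⟨fun I => or_iff_not_imp_left.2 (hcon I), hnonabelian⟩
  obtain ⟨I₀, hbot, htop⟩ := hideal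
  have hbr : ∃ X Y : E, groupBracket G X Y ≠ 0 := by
    by_contra! hcon
    exact hnonabelian ⟨fun X Y => hcon X Y⟩
  obtain ⟨X, Y, hXY⟩ := hbr
  obtain ⟨B, hsymm, hpos, hskew⟩ := exists_invariant_skew_bilinForm (E := E) (G := G)
  let I : Submodule ℝ E :=
    { carrier := {v : E | (show GroupLieAlgebra 𝓘(ℝ, E) G from v) ∈ I₀}
      add_mem' := fun ha hb => I₀.add_mem ha hb
      zero_mem' := I₀.zero_mem
      smul_mem' := fun c _ ha => I₀.smul_mem c ha }
  have hI : ∀ X, ∀ v ∈ I, groupBracket G X v ∈ I := fun X v hv =>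
    lie_mem_right ℝ _ I₀ (show GroupLieAlgebra 𝓘(ℝ, E) G from X) _ hv
  have hIbot : I ≠ ⊥ := fun h => hbot (by
    rw [LieSubmodule.eq_bot_iff]
    exact fun m hm => (Submodule.eq_bot_iff I).1 h m hm)
  have hItop : I ≠ ⊤ := fun h => htop (by
    rw [eq_top_iff]
    exact fun m _ => (Submodule.eq_top_iff'.1 h m))
  set J := B.orthogonal I with hJdef
  have hrefl : B.IsRefl := fun u v h => by rw [hsymm]; exact h
  have hIJ : IsCompl I J := by
    rw [hJdef, LinearMap.BilinForm.isCompl_orthogonal_iff_disjoint hrefl, Submodule.disjoint_def]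
    intro u hu hu'
    by_contra hne
    exact (hpos u hne).ne' (hu' u hu)
  have hJ : ∀ X, ∀ v ∈ J, groupBracket G X v ∈ J := by
    intro X v hv u hu
    have h1 := hskew X u v
    have h2 : B (groupBracket G X u) v = 0 := hv _ (hI X u hu)
    rw [h2] at h1
    exact (neg_eq_zero.1 h1.symm)
  have hJbot : J ≠ ⊥ := fun h => hItop (by simpa [h] using hIJ.sup_eq_top)
  -- Brackets between `I` and `J` lie in `I ∩ J = 0`, so a nonzero bracket must come from within one
  -- summand.
  have hsplit : groupBracket G X Y ≠ 0 → (∃ x ∈ I, ∃ y ∈ I, groupBracket G x y ≠ 0) ∨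
      ∃ x ∈ J, ∃ y ∈ J, groupBracket G x y ≠ 0 := by
    contrapose!
    rintro ⟨h1, h2⟩
    obtain ⟨i, hi, j, hj, rfl⟩ := Submodule.mem_sup.1
      (hIJ.sup_eq_top ▸ Submodule.mem_top : X ∈ I ⊔ J)
    obtain ⟨i', hi', j', hj', rfl⟩ := Submodule.mem_sup.1
      (hIJ.sup_eq_top ▸ Submodule.mem_top : Y ∈ I ⊔ J)
    have h3 {a b : E} (ha : a ∈ I) (hb : b ∈ J) : groupBracket G a b = 0 :=
      (Submodule.disjoint_def.1 hIJ.disjoint) _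
        (by rw [groupBracket_skew]; exact I.neg_mem (hI _ _ ha)) (hJ _ _ hb)
    have h4 := h3 hi' hj
    rw [groupBracket_skew, neg_eq_zero] at h4
    have h5 := h1 i hi i' hi'
    have h6 := h2 j hj j' hj'
    have h7 := h3 hi hj'
    simp only [← derivOne_adHom] at h4 h5 h6 h7 ⊢
    simp [h4, h5, h6, h7]
  rcases hsplit hXY with h | h
  · exact exists_representations_of_isCompl hpos hskew hIJ hJ hI hJbot h
  · exact exists_representations_of_isCompl hpos hskew hIJ.symm hI hJ hIbot h

end Core

/-! ### The sequence of representations and its constant normalized character. -/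

theorem mainTheorem5
    {E : Type*} [NormedAddCommGroup E] [NormedSpace ℝ E] [FiniteDimensional ℝ E]
    {G : Type*} [TopologicalSpace G] [ChartedSpace E G] [Group G] [LieGroup 𝓘(ℝ, E) ∞ G]
    [T2Space G] [CompactSpace G] [ConnectedSpace G]
    (hnonabelian : ¬ IsLieAbelian (GroupLieAlgebra 𝓘(ℝ, E) G))
    (hnonsimple : ¬ LieAlgebra.IsSimple ℝ (GroupLieAlgebra 𝓘(ℝ, E) G)) :
    ∃ (g : G) (d : ℕ → ℕ) (ρ : ∀ k, Representation ℂ G (EuclideanSpace ℂ (Fin (d k)))),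
      g ≠ 1 ∧
      (∀ k, (ρ k).IsContinuousRep ∧ (ρ k).IsIrreducible) ∧
      Tendsto d atTop atTop ∧
      ¬ Tendsto (fun k => (ρ k).normalizedCharacter g) atTop (𝓝 0) := by
  obtain ⟨g₀, hg₀, hrep⟩ := exists_representations hnonabelian hnonsimple
  choose d σ hd hcont hone hirr using hrep
  let ρ : ∀ k, Representation ℂ G (EuclideanSpace ℂ (Fin (d k))) := fun k =>
    (ContinuousLinearMap.toLinearMapRingHom : _ →+* _).toMonoidHom.comp (σ k)
  refine ⟨g₀, d, ρ, hg₀, fun k => ⟨?_, ?_⟩, ?_, ?_⟩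
  · exact ((hcont k).comp continuous_fst).clm_apply continuous_snd
  · have : Nontrivial (EuclideanSpace ℂ (Fin (d k))) :=
      -- The strict bound `k < d k` excludes the zero space, on which having no invariant subspaces
      -- would be vacuous.
      Module.nontrivial_of_finrank_pos (R := ℂ) (by simpa using (Nat.zero_le k).trans_lt (hd k))
    have : Nontrivial (Subrepresentation (ρ k)) :=
      ⟨⊥, ⊤, fun h => bot_ne_top (congrArg Subrepresentation.toSubmodule h)⟩
    refine ⟨fun S => ?_⟩
    exact (hirr k S.toSubmodule fun g v hv => S.apply_mem_toSubmodule g hv).imp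
      (fun h => Subrepresentation.toSubmodule_injective h)
      (fun h => Subrepresentation.toSubmodule_injective h)
  · exact tendsto_atTop_mono (fun k => (hd k).le) tendsto_id
  · have hchar (k : ℕ) : (ρ k).normalizedCharacter g₀ = 1 := by
      have h1 : ρ k g₀ = 1 := by
        simp [ρ, hone]
      have h2 : (d k : ℂ) ≠ 0 := by
        exact_mod_cast ((Nat.zero_le k).trans_lt (hd k)).ne'
      rw [Representation.normalizedCharacter, Representation.character, h1, LinearMap.trace_one]
      simp [h2]
    simp only [hchar]
    rw [tendsto_const_nhds_iff]
    exact one_ne_zero
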